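/- Setting. Each quantum variable $q$ has a nonzero finite-dimensional Hilbert space $\mathcal H_q$ as its type, each classical variable $x$ has a set $D_x$ of values, and $\mathcal H_V=\bigotimes_{q\in V}\mathcal H_q$ for a finite set $V$ of quantum variables. Operators on $\mathcal H_V$ are extended to $\mathcal H_W$, $W\supseteq V$, by tensoring with the identity. QGCL programs $P$, with their quantum variables $qvar(P)$ and classical variables $var(P)$, are built from $\mathbf{abort}$ and $\mathbf{skip}$ (no variables) by: unitary statements $U[\overline q]$; measurements $M[x\leftarrow\overline q]:\{P_m\}$, where $M=\{M_m\}$ has finitely many outcomes $m\in D_x$, $\sum_m M_m^\dagger M_m=I$ and $x\notin\bigcup_m var(P_m)$; guarded commands $\square_{i=1}^n\ \overline q,|i\rangle\to P_i$, where $\{|i\rangle\}$ is an orthonormal basis of $\mathcal H_{\overline q}$ and $\overline q\cap\bigcup_i qvar(P_i)=\emptyset$; and sequential compositions $P_1;P_2$ with $var(P_1)\cap var(P_2)=\emptyset$. Here $qvar(U[\overline q])=\overline q$, the program variables of a compound statement are those of its subprograms together with $\overline q$ (and $x$ for a measurement). Semantics. The semi-classical semantics $\lceil P\rceil:\Delta(P)\to\mathcal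 L(\mathcal H_{qvar(P)})$ is defined by: $\Delta=\{\epsilon\}$ and $\lceil\mathbf{abort}\rceil(\epsilon)=0$, $\lceil\mathbf{skip}\rceil(\epsilon)=1$, $\lceil U[\overline q]\rceil(\epsilon)=U$; $\lceil M[x\leftarrow\overline q]:\{P_m\}\rceil(\delta[x\leftarrow m])=\lceil P_m\rceil(\delta)\,M_m$ for $\delta\in\Delta(P_m)$; $\lceil P_1;P_2\rceil(\delta_1\delta_2)=\lceil P_2\rceil(\delta_2)\lceil P_1\rceil(\delta_1)$ for $\delta_i\in\Delta(P_i)$; and for $P=\square_i\,\overline q,|i\rangle\to P_i$, with $F_i$ the extension of $\lceil P_i\rceil$ to $V=\bigcup_i qvar(P_i)$ and $\delta_i\in\Delta(P_i)$, $$\lceil P\rceil(\oplus_i\delta_i)\Big(\sum_i|\psi_i\rangle|i\rangle\Big)=\sum_i\Big(\prod_{k\ne i}\lambda_{k\delta_k}\Big)(F_i(\delta_i)|\psi_i\rangle)|i\rangle,\qquad \lambda_{k\delta}=\sqrt{\frac{\mathrm{tr}\,F_k(\delta)^\dagger F_k(\delta)}{\sum_\tau\mathrm{tr}\,F_k(\tau)^\dagger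 F_k(\tau)}},$$ where $\lambda_{k\delta}=1/\sqrt{|\Delta(P_k)|}$ if $F_k$ is identically zero. The purely quantum semantics is $\llbracket P\rrbracket(\rho)=\sum_{\delta\in\Delta(P)}\lceil P\rceil(\delta)\,\rho\,\lceil P\rceil(\delta)^\dagger$. For $\overline r\subseteq qvar(P)$ and a density operator $\rho$ on $\mathcal H_{\overline r}$, the block $\mathbf{begin\ local}\ \overline r:=\rho;P\ \mathbf{end}$ has quantum variables $qvar(P)\setminus\overline r$ and semantics $\sigma\mapsto \mathrm{tr}_{\mathcal H_{\overline r}}(\llbracket P\rrbracket(\sigma\otimes\rho))$; one writes $\overline r:=|\varphi\rangle$ for $\rho=|\varphi\rangle\langle\varphi|$. Two commands are equivalent ($\equiv$) if they have the same quantum variables and the same purely quantum semantics. If $\overline q=qvar(P)$, the quantum choice $\bigoplus_{i=1}^n P,|i\rangle\to P_i$ is the program $P;\square_{i=1}^n\ \overline q,|i\rangle\to P_i$. Theorem. (1) Let $U$ be a unitary operator on $\mathcal H_{\overline q}$, $\{|i\rangle\}_{i=1}^n$ an orthonormal basis of $\mathcal H_{\overline q}$, and $P_1,\dots,P_n$ programs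 with $\overline q\cap\bigcup_i qvar(P_i)=\emptyset$. Then $$\bigoplus_{i=1}^n U[\overline q],|i\rangle\to P_i\ \equiv\ \big(\square_{i=1}^n\ \overline q,\,U^\dagger|i\rangle\to P_i\big);U[\overline q],$$ and the right-hand side is a QGCL program. (2) Suppose that infinitely many quantum variables have a type of dimension at least $2$. Let $\bigoplus_{i=1}^n P,|i\rangle\to P_i$ be any quantum choice (a QGCL program), and $\overline q=qvar(P)$. Then there are a finite set $\overline r$ of quantum variables disjoint from $\overline q\cup\bigcup_i qvar(P_i)$, a unit vector $|\varphi_0\rangle\in\mathcal H_{\overline r}$, a finite index set $J$, an orthonormal basis $\{|\psi_{ij}\rangle\}_{1\le i\le n,\,j\in J}$ of $\mathcal H_{\overline q}\otimes\mathcal H_{\overline r}$, programs $Q_{ij}$, each of which is $P_i$ or $\mathbf{abort}$, and a unitary operator $U$ on $\mathcal H_{\overline q}\otimes\mathcal H_{\overline r}$ such that $$\bigoplus_{i=1}^n P,|i\rangle\to P_i\ \equiv\ \mathbf{begin\ local}\ \overline r:=|\varphi_0\rangle;\ \big(\square_{i,j}\ |\psi_{ij}\rangle\to Q_{ij}\big);U[\overline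 q,\overline r]\ \mathbf{end},$$ and the body of the block is a QGCL program. -/

import Mathlib

open scoped Matrix ComplexOrder

/-
QGCL: a purely quantum language with quantum guarded commands.

* `QV` is the set of quantum variables. The type of `q : QV` is the finite-dimensional Hilbert
  space `ℂ^(B q)` with computational basis labelled by `B q`.
* `CV` is the set of classical variables, and `D x` is the set of values of `x : CV`.
-/
namespace QGCL

universe u v w

variable {QV : Type u} {CV : Type*} [DecidableEq QV]
variable {B : QV → Type v} [∀ q, Fintype (B q)] [∀ q, DecidableEq (B q)]
variable {D : CV → Type w}

/-- Labels of the computational (product) basis of the state space of the variables in `V`. -/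
abbrev Conf (B : QV → Type*) (V : Finset QV) : Type _ := (q : V) → B q

/-- The state space `⨂_{q ∈ V} H_q` of the variables in `V`. -/
abbrev Hsp (B : QV → Type*) (V : Finset QV) : Type _ := EuclideanSpace ℂ (Conf B V)

/-- Operators on the state space of `V`, as matrices in the computational basis. -/
abbrev Op (B : QV → Type*) (V : Finset QV) : Type _ := Matrix (Conf B V) (Conf B V) ℂ

/-- Cylindrical extension `A ⊗ I` of an operator on the variables `V` to the variables `W ⊇ V`. -/
def cyl {V W : Finset QV} (h : V ⊆ W) (A : Op B V) : Op B W := fun c c' =>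
  if Finset.restrict₂ (π := B) (W.sdiff_subset (t := V)) c
      = Finset.restrict₂ (π := B) (W.sdiff_subset (t := V)) c'
  then A (Finset.restrict₂ (π := B) h c) (Finset.restrict₂ (π := B) h c') else 0

/-- The rank-one operator `|φ⟩⟨φ|`. -/
def ketbra {V : Finset QV} (φ : Hsp B V) : Op B V :=
  Matrix.vecMulVec φ.ofLp (star φ.ofLp)

/-- The orthonormal basis `{U |i⟩}` obtained by applying a unitary `U` to the basis `{|i⟩}`. -/
noncomputable def rotate {V : Finset QV} {ι : Type} [Fintype ι]
    (U : Matrix.unitaryGroup (Conf B V) ℂ) (b : OrthonormalBasis ι ℂ (Hsp B V)) :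
    OrthonormalBasis ι ℂ (Hsp B V) :=
  b.map (Unitary.linearIsometryEquiv
    ⟨Matrix.toEuclideanCLM (n := Conf B V) (𝕜 := ℂ) U.1, Unitary.map_mem _ U.2⟩)

theorem rotate_apply {V : Finset QV} {ι : Type} [Fintype ι]
    (U : Matrix.unitaryGroup (Conf B V) ℂ) (b : OrthonormalBasis ι ℂ (Hsp B V)) (i : ι) :
    rotate U b i = WithLp.toLp 2 ((U : Op B V) *ᵥ (b i).ofLp) := by
  rfl

/-- A quantum measurement with outcomes in the finite set `O`. -/
structure Measurement (B : QV → Type*) [∀ q, Fintype (B q)] [∀ q, DecidableEq (B q)]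
    (V : Finset QV) (O : Type*) [Fintype O] where
  op : O → Op B V
  complete : ∑ m, (op m)ᴴ * op m = 1

/-- Raw syntax of QGCL; the side conditions on variables are in `Prog.WF`. -/
inductive Prog (B : QV → Type*) [∀ q, Fintype (B q)] [∀ q, DecidableEq (B q)]
    (D : CV → Type*) where
  | abort : Prog B D
  | skip : Prog B D
  /-- `U[q]` -/
  | unitary (q : Finset QV) (U : Matrix.unitaryGroup (Conf B q) ℂ) : Prog B D
  /-- `M[x ← q] : {P_m}`, with `spec M = S ⊆ D x` -/
  | meas (q : Finset QV) (x : CV) (S : Finset (D x)) (M : Measurement B q S)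
      (P : S → Prog B D) : Prog B D
  /-- `□_i q, |i⟩ → P_i` along the orthonormal basis `b = {|i⟩}` -/
  | guard (q : Finset QV) (ι : Type) [Fintype ι] (b : OrthonormalBasis ι ℂ (Hsp B q))
      (P : ι → Prog B D) : Prog B D
  /-- `P₁; P₂` -/
  | seq (P₁ P₂ : Prog B D) : Prog B D

namespace Prog

/-- Quantum variables. -/
def qvar : Prog B D → Finset QV
  | abort => ∅
  | skip => ∅
  | unitary q _ => q
  | meas q _ _ _ P => q ∪ Finset.univ.biUnion fun m => (P m).qvar
  | guard q _ _ P => q ∪ Finset.univ.biUnion fun i => (P i).qvar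
  | seq P₁ P₂ => P₁.qvar ∪ P₂.qvar

/-- Classical variables. -/
def var : Prog B D → Set CV
  | abort => ∅
  | skip => ∅
  | unitary _ _ => ∅
  | meas _ x _ _ P => {x} ∪ ⋃ m, (P m).var
  | guard _ _ _ P => ⋃ i, (P i).var
  | seq P₁ P₂ => P₁.var ∪ P₂.var

/-- The side conditions under which a raw term is a QGCL program. -/
def WF : Prog B D → Prop
  | abort => True
  | skip => True
  | unitary _ _ => True
  | meas _ x _ _ P => (x ∉ ⋃ m, (P m).var) ∧ ∀ m, (P m).WF
  | guard q _ _ P => (∀ i, Disjoint q (P i).qvar) ∧ ∀ i, (P i).WF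
  | seq P₁ P₂ => Disjoint P₁.var P₂.var ∧ P₁.WF ∧ P₂.WF

/-- The classical states `Δ(P)`. The state `ε` is the unique element of the unit type,
`δ[x ← m]` with `δ ∈ Δ(P_m)` is the pair `⟨m, δ⟩`, `⊕_i δ_i` is the tuple `(δ_i)_i`, and `δ₁ δ₂` is
the pair `(δ₁, δ₂)`. For a well-formed program the components can be read off from the state, as
`δ₁` and `δ₂` have disjoint domains. -/
def State : Prog B D → Type w
  | abort => PUnit
  | skip => PUnit
  | unitary _ _ => PUnit
  | meas _ _ S _ P => Σ m : S, (P m).State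
  | guard _ ι _ P => (i : ι) → (P i).State
  | seq P₁ P₂ => P₁.State × P₂.State

open Classical in
noncomputable instance instFintypeState : (P : Prog B D) → Fintype P.State
  | abort => inferInstanceAs (Fintype PUnit)
  | skip => inferInstanceAs (Fintype PUnit)
  | unitary _ _ => inferInstanceAs (Fintype PUnit)
  | meas _ _ S _ P =>
      letI : ∀ m, Fintype (P m).State := fun m => instFintypeState (P m)
      inferInstanceAs (Fintype (Σ m : S, (P m).State))
  | guard _ ι _ P =>
      letI : ∀ i, Fintype (P i).State := fun i => instFintypeState (P i)
      inferInstanceAs (Fintype ((i : ι) → (P i).State))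
  | seq P₁ P₂ =>
      letI := instFintypeState P₁
      letI := instFintypeState P₂
      inferInstanceAs (Fintype (P₁.State × P₂.State))

end Prog

/-- The coefficients `λ_δ = √(tr F(δ)†F(δ) / ∑_τ tr F(τ)†F(τ))` of an operator-valued function `F`.
If `F` vanishes identically, this quotient is `0/0`; then `λ` is the uniform family `1/√|Δ|`, so that
`∑_δ λ_δ² = 1` in all cases, and `λ = 1` whenever `Δ` is a singleton. -/
noncomputable def coef {V : Finset QV} {Δ : Type*} [Fintype Δ] (F : Δ → Op B V) (δ : Δ) : ℝ :=
  if ∑ τ, ((F τ)ᴴ * F τ).trace.re = 0 then √(1 / (Fintype.card Δ : ℝ))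
  else √(((F δ)ᴴ * F δ).trace.re / ∑ τ, ((F τ)ᴴ * F τ).trace.re)

open Classical in
/-- Guarded composition `□_i |i⟩ → F_i` of operator-valued functions `F_i` on the variables `V`
along an orthonormal basis `b = {|i⟩}` of the state space of `q`, where `q` and `V` are disjoint:
`F(⊕δ_i) (∑_i |ψ_i⟩|i⟩) = ∑_i (∏_{k ≠ i} λ_{k δ_k}) (F_i(δ_i)|ψ_i⟩)|i⟩`. -/
noncomputable def guardComp (q V : Finset QV) {ι : Type} [Fintype ι]
    (b : OrthonormalBasis ι ℂ (Hsp B q)) {Δ : ι → Type*} [∀ i, Fintype (Δ i)]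
    (F : (i : ι) → Δ i → Op B V) (δ : (i : ι) → Δ i) : Op B (q ∪ V) :=
  ∑ i, ((∏ k ∈ Finset.univ.erase i, coef (F k) (δ k) : ℝ) : ℂ) •
    (cyl Finset.subset_union_right (F i (δ i)) * cyl Finset.subset_union_left (ketbra (b i)))

namespace Prog

/-- Semi-classical denotational semantics `⌈P⌉`. -/
noncomputable def sem : (P : Prog B D) → P.State → Op B P.qvar
  | abort => fun _ => 0
  | skip => fun _ => 1
  | unitary _ U => fun _ => U.1
  | meas q x S M P => fun (δ : Σ m : S, (P m).State) =>
      cyl (W := (meas q x S M P).qvar)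
          ((Finset.subset_biUnion_of_mem (fun m => (P m).qvar) (Finset.mem_univ δ.1)).trans
            Finset.subset_union_right) ((P δ.1).sem δ.2)
        * cyl (W := (meas q x S M P).qvar) Finset.subset_union_left (M.op δ.1)
  | guard q _ b P =>
      guardComp q (Finset.univ.biUnion fun i => (P i).qvar) b fun i δ =>
        cyl (Finset.subset_biUnion_of_mem (fun i => (P i).qvar) (Finset.mem_univ i)) ((P i).sem δ)
  | seq P₁ P₂ => fun (δ : P₁.State × P₂.State) =>
      cyl (W := (seq P₁ P₂).qvar) Finset.subset_union_right (P₂.sem δ.2)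
        * cyl (W := (seq P₁ P₂).qvar) Finset.subset_union_left (P₁.sem δ.1)

/-- Purely quantum denotational semantics `⟦P⟧ = ∑_δ ⌈P⌉(δ) ∘ ⌈P⌉(δ)†`. -/
noncomputable def denote (P : Prog B D) (ρ : Op B P.qvar) : Op B P.qvar :=
  ∑ δ : P.State, P.sem δ * ρ * (P.sem δ)ᴴ

/-- Quantum choice `⊕_i P, |i⟩ → P_i`, that is, `P; □_i q, |i⟩ → P_i` with `q = qvar(P)`. -/
def choice (P : Prog B D) {ι : Type} [Fintype ι] (b : OrthonormalBasis ι ℂ (Hsp B P.qvar))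
    (R : ι → Prog B D) : Prog B D :=
  seq P (guard P.qvar ι b R)

end Prog

/-- Density operators on the state space of `V`. -/
structure DensityOp (B : QV → Type*) [∀ q, Fintype (B q)] (V : Finset QV) where
  val : Op B V
  posSemidef : val.PosSemidef
  trace_one : val.trace = 1

/-- The pure state `|φ⟩⟨φ|` of a unit vector `|φ⟩`. -/
def DensityOp.pure {V : Finset QV} (φ : Hsp B V) (hφ : ‖φ‖ = 1) : DensityOp B V where
  val := ketbra φ
  posSemidef := Matrix.posSemidef_vecMulVec_self_star φ.ofLp
  trace_one := by
    have h : inner ℂ φ φ = (1 : ℂ) := by simp [inner_self_eq_norm_sq_to_K, hφ]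
    rw [ketbra, Matrix.trace_vecMulVec]
    rwa [EuclideanSpace.inner_eq_star_dotProduct] at h

/-- The product operator `σ ⊗ ρ` on the variables `W`, where `r ⊆ W`. -/
def tensor {r W : Finset QV} (h : r ⊆ W) (σ : Op B (W \ r)) (ρ : Op B r) : Op B W := fun c c' =>
  σ (Finset.restrict₂ (π := B) Finset.sdiff_subset c)
      (Finset.restrict₂ (π := B) Finset.sdiff_subset c')
    * ρ (Finset.restrict₂ (π := B) h c) (Finset.restrict₂ (π := B) h c')

/-- The configuration of `W` with the values `a` outside `r` and `s` on `r`. -/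
def glue {r W : Finset QV} (a : Conf B (W \ r)) (s : Conf B r) : Conf B W := fun x =>
  if hx : x.1 ∈ r then s ⟨x.1, hx⟩ else a ⟨x.1, Finset.mem_sdiff.2 ⟨x.2, hx⟩⟩

/-- Partial trace over the variables `r`. -/
def ptrace {r W : Finset QV} (A : Op B W) : Op B (W \ r) := fun a a' =>
  ∑ s : Conf B r, A (glue a s) (glue a' s)

/-- Commands: QGCL programs, and blocks `begin local r := ρ; P end` with `r ⊆ qvar(P)`. -/
inductive Cmd (B : QV → Type*) [∀ q, Fintype (B q)] [∀ q, DecidableEq (B q)]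
    (D : CV → Type*) where
  | prog (P : Prog B D) : Cmd B D
  | block (r : Finset QV) (ρ : DensityOp B r) (P : Prog B D) (h : r ⊆ P.qvar) : Cmd B D

namespace Cmd

/-- Quantum variables of a command; local variables are removed. -/
def qvar : Cmd B D → Finset QV
  | prog P => P.qvar
  | block r _ P _ => P.qvar \ r

/-- A command is well-formed if the program it is made of is. -/
def WF : Cmd B D → Prop
  | prog P => P.WF
  | block _ _ P _ => P.WF

/-- Purely quantum denotational semantics; for blocks, `σ ↦ tr_r (⟦P⟧ (σ ⊗ ρ))`. -/
noncomputable def denote : (C : Cmd B D) → Op B C.qvar → Op B C.qvar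
  | prog P => P.denote
  | block _ ρ P h => fun σ => ptrace (P.denote (tensor h σ ρ.val))

/-- Equivalence of commands: the same quantum variables and the same super-operator. As the two sets
of quantum variables are only provably equal, operators on the one are relabelled to the other. -/
def Equivalent (C C' : Cmd B D) : Prop :=
  ∃ h : C.qvar = C'.qvar, ∀ ρ : Op B C.qvar,
    C'.denote (ρ.submatrix (Finset.restrict₂ (π := B) h.subset) (Finset.restrict₂ (π := B) h.subset))
      = (C.denote ρ).submatrix (Finset.restrict₂ (π := B) h.subset)
          (Finset.restrict₂ (π := B) h.subset)

end Cmd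

end QGCL

/-! Both parts compare Kraus operators of the form `∑ i, c i • (F i * X i)`, where `F i` belongs to
a branch, `X i` acts on the coin, and `c i` is a product of coefficients depending only on the
branches (`coef_cyl`). This form is `guardedOp`; coin operators acting before or after the guard are
absorbed into `X`, since they commute with the branches.

Unitary coin: `U |U†i⟩⟨U†i| = |i⟩⟨i| U` (`mul_ketbra_rotate_inv`), so the two programs have the same
Kraus operators.

General coin: the Kraus operators of `P` satisfy `∑ K†K ≤ 1` (`Prog.posSemidef_one_sub_sum_sem`).
Adding one operator makes the sum equal to 1, and a Stinespring dilation on a large enough fresh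
register `r` gives a unitary `U` with `⟨s|U|s₀⟩ = L s`, where `L` lists the Kraus operators
(`exists_dilation`). The guard runs along `U†(|i⟩|j⟩)`, with `R i` at `(i, j)` if `j` labels a
genuine Kraus operator and `abort` otherwise. By the identity above, starting from `|s₀⟩` the
register records `j` and the coin receives `|i⟩⟨i| L j`.

Tracing out `r` removes interference between different `j`. The coefficients of the branches in the
other columns only multiply the `j`-th term by weights whose squares sum to 1 (`sum_coef_sq`), so
each column yields the guarded sum for one Kraus operator (`ptrace_guardedSum`). Columns filled with
`abort` yield 0, and the others add up to the quantum choice. -/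

set_option linter.unusedSectionVars false

namespace QGCL

universe u v w

variable {QV : Type u} {CV : Type*} [DecidableEq QV]
variable {B : QV → Type v} [∀ q, Fintype (B q)] [∀ q, DecidableEq (B q)]
variable {D : CV → Type w}

/-! ### Cylindrical extension -/

/-- Configurations of `W` as pairs of configurations of `V ⊆ W` and of its complement. -/
def confSplit {V W : Finset QV} (h : V ⊆ W) : Conf B W ≃ Conf B V × Conf B (W \ V) where
  toFun c := (Finset.restrict₂ (π := B) h c, Finset.restrict₂ (π := B) Finset.sdiff_subset c)
  invFun p x := if hx : x.1 ∈ V then p.1 ⟨x.1, hx⟩ else p.2 ⟨x.1, Finset.mem_sdiff.2 ⟨x.2, hx⟩⟩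
  left_inv c := by
    ext x
    by_cases hx : x.1 ∈ V <;> simp [hx, Finset.restrict₂]
  right_inv p := by
    ext x
    · simp [Finset.restrict₂]
    · have := (Finset.mem_sdiff.1 x.2).2
      simp [Finset.restrict₂, this]

-- Multiplicativity, unitality and compatibility with adjoints and traces are inherited from the
-- Kronecker product through this form.
open scoped Kronecker in
theorem cyl_eq_submatrix {V W : Finset QV} (h : V ⊆ W) (A : Op B V) :
    cyl h A = (A ⊗ₖ (1 : Op B (W \ V))).submatrix (confSplit h) (confSplit h) := by
  ext c c'
  simp [cyl, confSplit, Matrix.one_apply]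

theorem cyl_mul {V W : Finset QV} (h : V ⊆ W) (A C : Op B V) :
    cyl h (A * C) = cyl h A * cyl h C := by
  simp only [cyl_eq_submatrix]
  rw [Matrix.submatrix_mul_equiv, ← Matrix.mul_kronecker_mul, one_mul]

theorem cyl_one {V W : Finset QV} (h : V ⊆ W) : cyl h (1 : Op B V) = 1 := by
  simp only [cyl_eq_submatrix]
  simp

theorem cyl_conjTranspose {V W : Finset QV} (h : V ⊆ W) (A : Op B V) :
    cyl h Aᴴ = (cyl h A)ᴴ := by
  simp only [cyl_eq_submatrix]
  rw [Matrix.conjTranspose_submatrix, Matrix.conjTranspose_kronecker, Matrix.conjTranspose_one]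

theorem cyl_add {V W : Finset QV} (h : V ⊆ W) (A C : Op B V) :
    cyl h (A + C) = cyl h A + cyl h C := by
  ext c c'
  simp only [cyl, Matrix.add_apply]
  split_ifs <;> simp

theorem cyl_smul {V W : Finset QV} (h : V ⊆ W) (a : ℂ) (A : Op B V) :
    cyl h (a • A) = a • cyl h A := by
  ext c c'
  simp only [cyl, Matrix.smul_apply]
  split_ifs <;> simp

/-- Cylindrical extension as a linear map. -/
def cylLin {V W : Finset QV} (h : V ⊆ W) : Op B V →ₗ[ℂ] Op B W where
  toFun := cyl h
  map_add' := cyl_add h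
  map_smul' := cyl_smul h

theorem cyl_sum {V W : Finset QV} (h : V ⊆ W) {ι : Type*} (s : Finset ι) (A : ι → Op B V) :
    cyl h (∑ i ∈ s, A i) = ∑ i ∈ s, cyl h (A i) :=
  map_sum (cylLin h) A s

theorem cyl_sub {V W : Finset QV} (h : V ⊆ W) (A C : Op B V) :
    cyl h (A - C) = cyl h A - cyl h C :=
  map_sub (cylLin h) A C

theorem cyl_zero {V W : Finset QV} (h : V ⊆ W) : cyl h (0 : Op B V) = 0 :=
  map_zero (cylLin h)

theorem restrict₂_eq_iff {V W : Finset QV} (h : V ⊆ W) (c c' : Conf B W) :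
    Finset.restrict₂ (π := B) h c = Finset.restrict₂ (π := B) h c' ↔
      ∀ x (hx : x ∈ V), c ⟨x, h hx⟩ = c' ⟨x, h hx⟩ := by
  simp [funext_iff, Finset.restrict₂]

theorem cyl_cyl {V V' W : Finset QV} (h : V ⊆ V') (h' : V' ⊆ W) (A : Op B V) :
    cyl h' (cyl h A) = cyl (h.trans h') A := by
  ext c c'
  have key : (Finset.restrict₂ (π := B) (W.sdiff_subset (t := V)) c
      = Finset.restrict₂ (π := B) (W.sdiff_subset (t := V)) c') ↔
      (Finset.restrict₂ (π := B) (W.sdiff_subset (t := V')) c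
        = Finset.restrict₂ (π := B) (W.sdiff_subset (t := V')) c') ∧
      Finset.restrict₂ (π := B) (V'.sdiff_subset (t := V)) (Finset.restrict₂ (π := B) h' c)
        = Finset.restrict₂ (π := B) (V'.sdiff_subset (t := V))
            (Finset.restrict₂ (π := B) h' c') := by
    simp only [restrict₂_eq_iff, Finset.mem_sdiff]
    constructor
    · intro H
      exact ⟨fun x hx => H x ⟨hx.1, fun hV => hx.2 (h hV)⟩, fun x hx => H x ⟨h' hx.1, hx.2⟩⟩
    · rintro ⟨H₁, H₂⟩ x hx
      by_cases hV : x ∈ V'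
      · exact H₂ x ⟨hV, hx.2⟩
      · exact H₁ x ⟨hx.1, hV⟩
  simp only [cyl, key]
  split_ifs <;> first | rfl | tauto

theorem cyl_eq_submatrix_of_eq {V W : Finset QV} (h : V = W) (A : Op B V) :
    cyl h.subset A =
      A.submatrix (Finset.restrict₂ (π := B) h.subset) (Finset.restrict₂ (π := B) h.subset) := by
  subst h
  ext c c'
  have : Finset.restrict₂ (π := B) (V.sdiff_subset (t := V)) c
      = Finset.restrict₂ (π := B) (V.sdiff_subset (t := V)) c' := by
    rw [restrict₂_eq_iff]
    simp
  simp [cyl, this]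

/-- In the sum over intermediate configurations only one can contribute: it agrees with `c'` on `V₁`
and with `c` elsewhere. The resulting formula is symmetric in the two factors, which is why they
commute. -/
theorem cyl_mul_cyl_apply {V₁ V₂ W : Finset QV} (h₁ : V₁ ⊆ W) (h₂ : V₂ ⊆ W)
    (hd : Disjoint V₁ V₂) (A : Op B V₁) (C : Op B V₂) (c c' : Conf B W) :
    (cyl h₁ A * cyl h₂ C) c c' =
      if Finset.restrict₂ (π := B) (W.sdiff_subset (t := V₁ ∪ V₂)) c
        = Finset.restrict₂ (π := B) (W.sdiff_subset (t := V₁ ∪ V₂)) c'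
      then A (Finset.restrict₂ (π := B) h₁ c) (Finset.restrict₂ (π := B) h₁ c')
        * C (Finset.restrict₂ (π := B) h₂ c) (Finset.restrict₂ (π := B) h₂ c') else 0 := by
  have hd' : ∀ x, x ∈ V₁ → x ∉ V₂ := fun _ hx => Finset.disjoint_left.1 hd hx
  rw [Matrix.mul_apply, Finset.sum_eq_single fun x => if x.1 ∈ V₁ then c' x else c x]
  · have e₁ : Finset.restrict₂ (π := B) h₁ (fun x => if x.1 ∈ V₁ then c' x else c x)
        = Finset.restrict₂ (π := B) h₁ c' := by
      rw [restrict₂_eq_iff]; intro x hx; simp [hx]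
    have e₂ : Finset.restrict₂ (π := B) h₂ (fun x => if x.1 ∈ V₁ then c' x else c x)
        = Finset.restrict₂ (π := B) h₂ c := by
      rw [restrict₂_eq_iff]; intro x hx; exact if_neg fun h => hd' x h hx
    have e₃ : Finset.restrict₂ (π := B) (W.sdiff_subset (t := V₁)) c
        = Finset.restrict₂ (π := B) (W.sdiff_subset (t := V₁))
            (fun x => if x.1 ∈ V₁ then c' x else c x) := by
      rw [restrict₂_eq_iff]; intro x hx; simp [(Finset.mem_sdiff.1 hx).2]
    have e₄ : (Finset.restrict₂ (π := B) (W.sdiff_subset (t := V₂))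
            (fun x => if x.1 ∈ V₁ then c' x else c x)
          = Finset.restrict₂ (π := B) (W.sdiff_subset (t := V₂)) c') ↔
        Finset.restrict₂ (π := B) (W.sdiff_subset (t := V₁ ∪ V₂)) c
          = Finset.restrict₂ (π := B) (W.sdiff_subset (t := V₁ ∪ V₂)) c' := by
      simp only [restrict₂_eq_iff, Finset.mem_sdiff, Finset.mem_union]
      constructor
      · intro H x hx
        have := H x ⟨hx.1, fun h => hx.2 (Or.inr h)⟩
        rwa [if_neg fun h => hx.2 (Or.inl h)] at this
      · intro H x hx
        split_ifs with hV
        · rfl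
        · exact H x ⟨hx.1, by tauto⟩
    simp only [cyl, e₁, e₂, if_pos e₃, e₄]
    split_ifs <;> simp
  · intro d _ hne
    simp only [cyl]
    split_ifs with H₁ H₂
    · exfalso
      apply hne
      rw [restrict₂_eq_iff] at H₁ H₂
      funext x
      by_cases hx : x.1 ∈ V₁
      · simpa [hx] using H₂ x.1 (Finset.mem_sdiff.2 ⟨x.2, hd' _ hx⟩)
      · simpa [hx] using (H₁ x.1 (Finset.mem_sdiff.2 ⟨x.2, hx⟩)).symm
    all_goals simp
  · simp

theorem cyl_mul_cyl_comm {V₁ V₂ W : Finset QV} (h₁ : V₁ ⊆ W) (h₂ : V₂ ⊆ W)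
    (hd : Disjoint V₁ V₂) (A : Op B V₁) (C : Op B V₂) :
    cyl h₁ A * cyl h₂ C = cyl h₂ C * cyl h₁ A := by
  ext c c'
  rw [cyl_mul_cyl_apply h₁ h₂ hd, cyl_mul_cyl_apply h₂ h₁ hd.symm]
  simp only [restrict₂_eq_iff, Finset.union_comm V₁ V₂, mul_comm]

open scoped Kronecker in
theorem trace_cyl {V W : Finset QV} (h : V ⊆ W) (A : Op B V) :
    (cyl h A).trace = A.trace * Fintype.card (Conf B (W \ V)) := by
  rw [cyl_eq_submatrix, ← Matrix.trace_one, ← Matrix.trace_kronecker]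
  exact Fintype.sum_equiv (confSplit h) _ _ fun _ => rfl

open scoped MatrixOrder Matrix.Norms.L2Operator in
theorem _root_.Matrix.PosSemidef.exists_eq_conjTranspose_mul_self {n : Type*} [Fintype n]
    [DecidableEq n] {A : Matrix n n ℂ} (hA : A.PosSemidef) : ∃ C : Matrix n n ℂ, A = Cᴴ * C :=
  CStarAlgebra.nonneg_iff_eq_star_mul_self.mp hA.nonneg

theorem posSemidef_cyl {V W : Finset QV} (h : V ⊆ W) {A : Op B V} (hA : A.PosSemidef) :
    (cyl h A).PosSemidef := by
  obtain ⟨C, rfl⟩ := hA.exists_eq_conjTranspose_mul_self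
  rw [cyl_mul, cyl_conjTranspose]
  exact Matrix.posSemidef_conjTranspose_mul_self _

/-! ### Product operators and partial traces -/

theorem tensor_eq_cyl_mul_cyl {r W : Finset QV} (h : r ⊆ W) (σ : Op B (W \ r)) (ρ : Op B r) :
    tensor h σ ρ = cyl Finset.sdiff_subset σ * cyl h ρ := by
  ext c c'
  rw [cyl_mul_cyl_apply _ _ Finset.sdiff_disjoint, if_pos, tensor]
  rw [restrict₂_eq_iff]
  intro x hx
  simp only [Finset.mem_sdiff, Finset.mem_union] at hx
  tauto

theorem ptrace_cyl_mul_cyl {r W : Finset QV} (h : r ⊆ W) (σ : Op B (W \ r)) (ρ : Op B r) :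
    ptrace (r := r) (cyl (W := W) Finset.sdiff_subset σ * cyl h ρ) = ρ.trace • σ := by
  ext a a'
  have e₁ : ∀ (a : Conf B (W \ r)) (s : Conf B r),
      Finset.restrict₂ (π := B) (W.sdiff_subset (t := r)) (glue a s) = a := by
    intro a s
    funext x
    have := (Finset.mem_sdiff.1 x.2).2
    simp [glue, Finset.restrict₂, this]
  have e₂ : ∀ (a : Conf B (W \ r)) (s : Conf B r),
      Finset.restrict₂ (π := B) h (glue a s) = s := by
    intro a s
    funext x
    simp [glue, Finset.restrict₂]
  simp [← tensor_eq_cyl_mul_cyl, ptrace, tensor, e₁, e₂, Matrix.trace, Finset.mul_sum, mul_comm]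

/-- Partial trace as a linear map. -/
def ptraceLin {r W : Finset QV} : Op B W →ₗ[ℂ] Op B (W \ r) where
  toFun := ptrace
  map_add' A C := by
    ext a a'
    simp [ptrace, Finset.sum_add_distrib]
  map_smul' z A := by
    ext a a'
    simp [ptrace, Finset.mul_sum]

theorem ptrace_sum {r W : Finset QV} {ι : Type*} (s : Finset ι) (A : ι → Op B W) :
    ptrace (r := r) (∑ i ∈ s, A i) = ∑ i ∈ s, ptrace (A i) :=
  map_sum ptraceLin A s

/-! ### Normalised coefficients and marginals -/

theorem trace_conjTranspose_mul_self_re_nonneg {V : Finset QV} (A : Op B V) :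
    0 ≤ (Aᴴ * A).trace.re :=
  (Complex.le_def.1 (Matrix.posSemidef_conjTranspose_mul_self A).trace_nonneg).1

/-- The uniform default value of `coef` is what makes this true also for `F = 0`, as happens for
`abort`. -/
theorem sum_coef_sq {V : Finset QV} {Δ : Type*} [Fintype Δ] [Nonempty Δ] (F : Δ → Op B V) :
    ∑ δ, coef F δ ^ 2 = 1 := by
  by_cases h : ∑ τ, ((F τ)ᴴ * F τ).trace.re = 0
  · have hc : (Fintype.card Δ : ℝ) ≠ 0 := by simp
    simp [coef, h, hc]
  · have h₀ : 0 ≤ ∑ τ, ((F τ)ᴴ * F τ).trace.re :=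
      Finset.sum_nonneg fun τ _ => trace_conjTranspose_mul_self_re_nonneg _
    simp only [coef, if_neg h]
    rw [Finset.sum_congr rfl fun δ _ => Real.sq_sqrt
      (div_nonneg (trace_conjTranspose_mul_self_re_nonneg (F δ)) h₀), ← Finset.sum_div,
      div_self h]

/-- Numerator and denominator are scaled by the same nonzero dimension, so the coefficients do not
depend on the ambient set of variables. -/
theorem coef_cyl [∀ q, Nonempty (B q)] {V W : Finset QV} (h : V ⊆ W) {Δ : Type*} [Fintype Δ]
    (F : Δ → Op B V) (δ : Δ) : coef (fun τ => cyl h (F τ)) δ = coef F δ := by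
  have hd : (Fintype.card (Conf B (W \ V)) : ℝ) ≠ 0 :=
    Nat.cast_ne_zero.2 Fintype.card_ne_zero
  have key : ∀ τ, ((cyl h (F τ))ᴴ * cyl h (F τ)).trace.re
      = ((F τ)ᴴ * F τ).trace.re * Fintype.card (Conf B (W \ V)) := by
    intro τ
    rw [← cyl_conjTranspose, ← cyl_mul, trace_cyl, ← Complex.ofReal_natCast, Complex.re_mul_ofReal]
  simp only [coef, key, ← Finset.sum_mul, mul_eq_zero, hd, or_false,
    mul_div_mul_right _ _ hd]

/-- Normalised weights on independent coordinates: every coordinate but `i` is summed out to 1. -/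
theorem sum_pi_marginal {κ : Type*} [Fintype κ] [DecidableEq κ] {Δ : κ → Type*}
    [∀ k, Fintype (Δ k)] {K M : Type*} [CommSemiring K] [AddCommMonoid M] [Module K M]
    (f : (k : κ) → Δ k → K) (hf : ∀ k, ∑ x, f k x = 1) (i : κ) (g : Δ i → M) :
    ∑ δ : (k : κ) → Δ k, (∏ k ∈ Finset.univ.erase i, f k (δ k)) • g (δ i) = ∑ x, g x := by
  rw [Fintype.sum_equiv (Equiv.piSplitAt i Δ) _
    (fun p => (∏ k : {k // k ≠ i}, f k (p.2 k)) • g p.1)]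
  · rw [Fintype.sum_prod_type]
    refine Finset.sum_congr rfl fun x _ => ?_
    dsimp only
    rw [← Finset.sum_smul]
    have := Finset.prod_univ_sum (fun k : {k // k ≠ i} => (Finset.univ : Finset (Δ k)))
      (fun k x => f k x)
    simp only [hf, Finset.prod_const_one, Fintype.piFinset_univ] at this
    rw [← this, one_smul]
  · intro δ
    congr 1
    exact (Finset.prod_subtype _ (by simp) fun k => f k (δ k))

/-! ### Rank-one operators along an orthonormal basis -/

theorem conjTranspose_ketbra {V : Finset QV} (φ : Hsp B V) : (ketbra φ)ᴴ = ketbra φ := by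
  rw [ketbra, Matrix.conjTranspose_vecMulVec, star_star]

theorem ketbra_mul_ketbra {V : Finset QV} {ι : Type*} [Fintype ι] [DecidableEq ι]
    (b : OrthonormalBasis ι ℂ (Hsp B V)) (i j : ι) :
    ketbra (b i) * ketbra (b j) = if i = j then ketbra (b i) else 0 := by
  have h := b.inner_eq_ite i j
  rw [EuclideanSpace.inner_eq_star_dotProduct, dotProduct_comm] at h
  rw [ketbra, ketbra, Matrix.vecMulVec_mul_vecMulVec, h]
  split_ifs with hij
  · subst hij
    simp
  · ext; simp [Matrix.vecMulVec]

theorem sum_ketbra {V : Finset QV} {ι : Type*} [Fintype ι]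
    (b : OrthonormalBasis ι ℂ (Hsp B V)) : ∑ i, ketbra (b i) = 1 := by
  ext c c'
  have h := congrArg (fun x : Hsp B V => x c) (b.sum_repr' (EuclideanSpace.single c' 1))
  simpa [ketbra, Matrix.sum_apply, Matrix.vecMulVec, Matrix.one_apply, mul_comm,
    EuclideanSpace.inner_single_right] using h

/-- This moves the coin past the guard: `U` cancels `U⁻¹` on the ket, and the adjoint of `U⁻¹` on
the bra is `U`. -/
theorem mul_ketbra_rotate_inv {V : Finset QV} {ι : Type} [Fintype ι]
    (U : Matrix.unitaryGroup (Conf B V) ℂ) (b : OrthonormalBasis ι ℂ (Hsp B V)) (i : ι) :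
    (U : Op B V) * ketbra (rotate U⁻¹ b i) = ketbra (b i) * (U : Op B V) := by
  have h : (U : Op B V) * ((U⁻¹ : Matrix.unitaryGroup (Conf B V) ℂ) : Op B V) = 1 := by
    rw [← Submonoid.coe_mul, mul_inv_cancel, Submonoid.coe_one]
  have h' : star (((U⁻¹ : Matrix.unitaryGroup (Conf B V) ℂ) : Op B V) *ᵥ (b i).ofLp)
      = star (b i).ofLp ᵥ* (U : Op B V) := by
    rw [Matrix.star_mulVec]
    congr 1
    exact star_star (U : Op B V)
  rw [rotate_apply, ketbra, ketbra, Matrix.mul_vecMulVec, Matrix.vecMulVec_mul, h',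
    Matrix.mulVec_mulVec, h, Matrix.one_mulVec]

/-! ### Sums over classical states -/

namespace Prog

/-- The `Fintype` instance on `State` is defined by recursion, so sums over composite states are
carried along the identity equivalence to sums over pairs, tuples or dependent pairs. -/
theorem sum_state_seq {M : Type*} [AddCommMonoid M] (P Q : Prog B D)
    (f : P.State → Q.State → M) :
    ∑ δ : (seq P Q).State, f δ.1 δ.2 = ∑ s : P.State, ∑ t : Q.State, f s t := by
  rw [← Fintype.sum_prod_type']
  exact Fintype.sum_equiv (Equiv.refl (P.State × Q.State)) _ _ fun _ => rfl

open Classical in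
theorem sum_state_guard {M : Type*} [AddCommMonoid M] (q : Finset QV) {ι : Type} [Fintype ι]
    (b : OrthonormalBasis ι ℂ (Hsp B q)) (R : ι → Prog B D)
    (f : ((i : ι) → (R i).State) → M) :
    ∑ δ : (guard q ι b R).State, f δ = ∑ δ : (i : ι) → (R i).State, f δ :=
  Fintype.sum_equiv (Equiv.refl ((i : ι) → (R i).State)) _ _ fun _ => rfl

theorem sum_state_meas {M : Type*} [AddCommMonoid M] (q : Finset QV) (x : CV) (S : Finset (D x))
    (N : Measurement B q S) (R : S → Prog B D) (f : (m : S) → (R m).State → M) :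
    ∑ δ : (meas q x S N R).State, f δ.1 δ.2 = ∑ m, ∑ t : (R m).State, f m t := by
  rw [← Fintype.sum_sigma']
  exact Fintype.sum_equiv (Equiv.refl (Σ m : S, (R m).State)) _ _ fun _ => rfl

theorem nonempty_state [∀ q, Nonempty (B q)] (P : Prog B D) : Nonempty P.State := by
  induction P with
  | abort => exact ⟨PUnit.unit⟩
  | skip => exact ⟨PUnit.unit⟩
  | unitary q U => exact ⟨PUnit.unit⟩
  | meas q x S N R ih =>
    -- An empty sum cannot be the identity of a nonzero space, so a measurement has an outcome.
    have : Nonempty S := by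
      by_contra hS
      rw [not_nonempty_iff] at hS
      have h := N.complete
      rw [Finset.univ_eq_empty, Finset.sum_empty] at h
      exact zero_ne_one h
    obtain ⟨m⟩ := this
    obtain ⟨t⟩ := ih m
    exact ⟨⟨m, t⟩⟩
  | guard q ι b R ih => exact ⟨fun i => (ih i).some⟩
  | seq P Q ihP ihQ => exact ⟨(ihP.some, ihQ.some)⟩

end Prog

/-! ### Guarded sums of programs -/

open Classical in
/-- The operator `∑_i (∏_{k ≠ i} λ_{k δ_k}) ⌈R_i⌉(δ_i) X_i` on the variables `T`. -/
noncomputable def guardedOp {T : Finset QV} {ι : Type*} [Fintype ι] (R : ι → Prog B D)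
    (h : ∀ i, (R i).qvar ⊆ T) (X : ι → Op B T) (δ : (i : ι) → (R i).State) : Op B T :=
  ∑ i, ((∏ k ∈ Finset.univ.erase i, coef (R k).sem (δ k) : ℝ) : ℂ) •
    (cyl (h i) ((R i).sem (δ i)) * X i)

open Classical in
/-- The super-operator with the Kraus operators `guardedOp R h X δ`. -/
noncomputable def guardedSum {T : Finset QV} {ι : Type*} [Fintype ι] (R : ι → Prog B D)
    (h : ∀ i, (R i).qvar ⊆ T) (X : ι → Op B T) (ρ : Op B T) : Op B T :=
  ∑ δ : (i : ι) → (R i).State, guardedOp R h X δ * ρ * (guardedOp R h X δ)ᴴ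

theorem guardedOp_eq_sum {T : Finset QV} {ι : Type*} [Fintype ι] [DecidableEq ι]
    (R : ι → Prog B D) (h : ∀ i, (R i).qvar ⊆ T) (X : ι → Op B T) (δ : (i : ι) → (R i).State) :
    guardedOp R h X δ =
      ∑ i, ((∏ k ∈ Finset.univ.erase i, coef (R k).sem (δ k) : ℝ) : ℂ) •
        (cyl (h i) ((R i).sem (δ i)) * X i) := by
  unfold guardedOp
  congr!

theorem guardedSum_eq_sum {T : Finset QV} {ι : Type*} [Fintype ι] [DecidableEq ι]
    (R : ι → Prog B D) (h : ∀ i, (R i).qvar ⊆ T) (X : ι → Op B T) (ρ : Op B T) :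
    guardedSum R h X ρ =
      ∑ δ : (i : ι) → (R i).State, guardedOp R h X δ * ρ * (guardedOp R h X δ)ᴴ := by
  unfold guardedSum
  congr!

theorem cyl_guardedOp {T T' : Finset QV} (hT : T ⊆ T') {ι : Type*} [Fintype ι]
    (R : ι → Prog B D) (h : ∀ i, (R i).qvar ⊆ T) (X : ι → Op B T)
    (δ : (i : ι) → (R i).State) :
    cyl hT (guardedOp R h X δ)
      = guardedOp R (fun i => (h i).trans hT) (fun i => cyl hT (X i)) δ := by
  simp only [guardedOp, cyl_sum, cyl_smul, cyl_mul, cyl_cyl]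

theorem cyl_guardedSum {T T' : Finset QV} (hT : T ⊆ T') {ι : Type*} [Fintype ι]
    (R : ι → Prog B D) (h : ∀ i, (R i).qvar ⊆ T) (X : ι → Op B T) (ρ : Op B T) :
    cyl hT (guardedSum R h X ρ)
      = guardedSum R (fun i => (h i).trans hT) (fun i => cyl hT (X i)) (cyl hT ρ) := by
  simp only [guardedSum, cyl_sum, cyl_mul, cyl_conjTranspose, cyl_guardedOp]

theorem cyl_guardedSum_cyl {S T T' : Finset QV} (hT : T ⊆ T') {ι : Type*} [Fintype ι]
    (R : ι → Prog B D) (h : ∀ i, (R i).qvar ⊆ T) (hS : S ⊆ T) (A : ι → Op B S) (ρ : Op B T) :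
    cyl hT (guardedSum R h (fun i => cyl hS (A i)) ρ) = guardedSum R
      (fun i => (h i).trans hT) (fun i => cyl (hS.trans hT) (A i)) (cyl hT ρ) := by
  simp only [cyl_guardedSum, cyl_cyl]

theorem guardedOp_mul {T : Finset QV} {ι : Type*} [Fintype ι] (R : ι → Prog B D)
    (h : ∀ i, (R i).qvar ⊆ T) (X : ι → Op B T) (A : Op B T) (δ : (i : ι) → (R i).State) :
    guardedOp R h X δ * A = guardedOp R h (fun i => X i * A) δ := by
  simp only [guardedOp, Finset.sum_mul, Matrix.smul_mul, Matrix.mul_assoc]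

/-- An operator on variables disjoint from every branch commutes with the branch operators and so
reaches `X`. -/
theorem cyl_mul_guardedOp {S T : Finset QV} (hS : S ⊆ T) {ι : Type*} [Fintype ι]
    (R : ι → Prog B D) (h : ∀ i, (R i).qvar ⊆ T) (hd : ∀ i, Disjoint S (R i).qvar)
    (X : ι → Op B T) (A : Op B S) (δ : (i : ι) → (R i).State) :
    cyl hS A * guardedOp R h X δ = guardedOp R h (fun i => cyl hS A * X i) δ := by
  simp only [guardedOp, Finset.mul_sum, Matrix.mul_smul, ← Matrix.mul_assoc,
    cyl_mul_cyl_comm hS (h _) (hd _)]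

-- By `hX` cross terms between branches vanish. The diagonal term of branch `i` carries the squared
-- coefficients of the other branches, which sum out to 1 by `sum_pi_marginal`.
open Classical in
theorem sum_conjTranspose_guardedOp_mul_guardedOp [∀ q, Nonempty (B q)] {T : Finset QV}
    {ι : Type*} [Fintype ι] (R : ι → Prog B D) (h : ∀ i, (R i).qvar ⊆ T) (X : ι → Op B T)
    (hX : ∀ i j, i ≠ j → ∀ (s : (R i).State) (t : (R j).State),
      (cyl (h i) ((R i).sem s) * X i)ᴴ * (cyl (h j) ((R j).sem t) * X j) = 0) :
    ∑ δ : (i : ι) → (R i).State, (guardedOp R h X δ)ᴴ * guardedOp R h X δ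
      = ∑ i, ∑ s : (R i).State, (cyl (h i) ((R i).sem s) * X i)ᴴ *
          (cyl (h i) ((R i).sem s) * X i) := by
  have key : ∀ δ : (i : ι) → (R i).State, (guardedOp R h X δ)ᴴ * guardedOp R h X δ
      = ∑ i, (∏ k ∈ Finset.univ.erase i, ((coef (R k).sem (δ k) ^ 2 : ℝ) : ℂ)) •
        ((cyl (h i) ((R i).sem (δ i)) * X i)ᴴ * (cyl (h i) ((R i).sem (δ i)) * X i)) := by
    intro δ
    rw [guardedOp, Matrix.conjTranspose_sum, Finset.sum_mul]
    refine Finset.sum_congr rfl fun i _ => ?_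
    rw [Finset.mul_sum, Finset.sum_eq_single i]
    · rw [Matrix.conjTranspose_smul, Matrix.smul_mul, Matrix.mul_smul, smul_smul]
      congr 1
      simp [Finset.prod_mul_distrib, sq]
    · intro j _ hij
      rw [Matrix.conjTranspose_smul, Matrix.smul_mul, Matrix.mul_smul, hX i j hij.symm, smul_zero,
        smul_zero]
    · simp
  simp only [key]
  rw [Finset.sum_comm]
  refine Finset.sum_congr rfl fun i _ => ?_
  have := fun k => (R k).nonempty_state
  refine sum_pi_marginal (fun k s => ((coef (R k).sem s ^ 2 : ℝ) : ℂ)) (fun k => ?_) i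
    (fun s => (cyl (h i) ((R i).sem s) * X i)ᴴ * (cyl (h i) ((R i).sem s) * X i))
  rw [← Complex.ofReal_sum, sum_coef_sq, Complex.ofReal_one]

namespace Prog

theorem qvar_subset_guard (q : Finset QV) {ι : Type} [Fintype ι]
    (b : OrthonormalBasis ι ℂ (Hsp B q)) (R : ι → Prog B D) (i : ι) :
    (R i).qvar ⊆ (guard q ι b R).qvar :=
  (Finset.subset_biUnion_of_mem (fun i => (R i).qvar) (Finset.mem_univ i)).trans
    Finset.subset_union_right

theorem subset_qvar_guard (q : Finset QV) {ι : Type} [Fintype ι]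
    (b : OrthonormalBasis ι ℂ (Hsp B q)) (R : ι → Prog B D) : q ⊆ (guard q ι b R).qvar :=
  Finset.subset_union_left

theorem sem_guard [∀ q, Nonempty (B q)] (q : Finset QV) {ι : Type} [Fintype ι]
    (b : OrthonormalBasis ι ℂ (Hsp B q)) (R : ι → Prog B D) (δ : (i : ι) → (R i).State) :
    (guard q ι b R).sem δ = guardedOp R (qvar_subset_guard q b R)
      (fun i => cyl (subset_qvar_guard q b R) (ketbra (b i))) δ := by
  simp only [sem, guardComp, guardedOp, coef_cyl, cyl_cyl]
  rfl

end Prog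

/-! ### Contractivity of programs and Kraus forms of the two sides -/

namespace Prog

/-- Programs do not increase the trace. -/
theorem posSemidef_one_sub_sum_sem [∀ q, Nonempty (B q)] (P : Prog B D) (hP : P.WF) :
    (1 - ∑ δ : P.State, (P.sem δ)ᴴ * P.sem δ).PosSemidef := by
  -- Contractivity relative to an operator `X` applied beforehand: the extended inequality is
  -- conjugated by `X`. Compound statements are sums of such inequalities.
  have lift : ∀ (Q : Prog B D), (1 - ∑ δ : Q.State, (Q.sem δ)ᴴ * Q.sem δ).PosSemidef →
      ∀ (T : Finset QV) (h : Q.qvar ⊆ T) (X : Op B T),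
      (Xᴴ * X - ∑ δ : Q.State, (cyl h (Q.sem δ) * X)ᴴ * (cyl h (Q.sem δ) * X)).PosSemidef := by
    intro Q hQ T h X
    have := (posSemidef_cyl h hQ).conjTranspose_mul_mul_same X
    simpa only [cyl_sub, cyl_one, cyl_sum, cyl_mul, cyl_conjTranspose, Matrix.mul_sub,
      Matrix.sub_mul, Matrix.mul_sum, Matrix.sum_mul, Matrix.mul_one, Matrix.conjTranspose_mul,
      Matrix.mul_assoc] using this
  induction P with
  | abort =>
    have : ∑ δ : (abort : Prog B D).State, ((abort : Prog B D).sem δ)ᴴ * (abort : Prog B D).sem δ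
        = 0 := Finset.sum_eq_zero fun _ _ => by simp [sem]
    rw [this, sub_zero]
    exact Matrix.PosSemidef.one
  | skip =>
    have : ∑ δ : (skip : Prog B D).State, ((skip : Prog B D).sem δ)ᴴ * (skip : Prog B D).sem δ
        = 1 := by
      refine (Fintype.sum_equiv (Equiv.refl PUnit) _ (fun _ => (1 : Op B ∅)) fun _ => ?_).trans
        (by simp; rfl)
      simp [sem]
      rfl
    rw [this, sub_self]
    exact Matrix.PosSemidef.zero
  | unitary q U =>
    have : ∑ δ : (unitary q U : Prog B D).State,
        ((unitary q U : Prog B D).sem δ)ᴴ * (unitary q U : Prog B D).sem δ = 1 := by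
      refine (Fintype.sum_equiv (Equiv.refl PUnit) _ (fun _ => (1 : Op B q)) fun _ => ?_).trans
        (by simp; rfl)
      exact Matrix.mem_unitaryGroup_iff'.1 U.2
    rw [this, sub_self]
    exact Matrix.PosSemidef.zero
  | meas q x S N R ih =>
    have h₁ : ∀ m, (R m).qvar ⊆ (meas q x S N R).qvar := fun m =>
      (Finset.subset_biUnion_of_mem (fun m => (R m).qvar) (Finset.mem_univ m)).trans
        Finset.subset_union_right
    have h₂ : q ⊆ (meas q x S N R).qvar := Finset.subset_union_left
    have hsum := sum_state_meas q x S N R fun m t =>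
      (cyl (h₁ m) ((R m).sem t) * cyl h₂ (N.op m))ᴴ * (cyl (h₁ m) ((R m).sem t) * cyl h₂ (N.op m))
    have hone : (1 : Op B (meas q x S N R).qvar)
        = ∑ m, (cyl h₂ (N.op m))ᴴ * cyl h₂ (N.op m) := by
      rw [← cyl_one h₂, ← N.complete]
      simp only [cyl_sum, cyl_mul, cyl_conjTranspose]
    refine Eq.subst (motive := fun A => (1 - A).PosSemidef) hsum.symm ?_
    rw [hone, ← Finset.sum_sub_distrib]
    exact Matrix.posSemidef_sum _ fun m _ => lift (R m) (ih m (hP.2 m)) _ (h₁ m) _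
  | guard q ι b R ih =>
    classical
    rw [sum_state_guard q b R fun δ => ((guard q ι b R).sem δ)ᴴ * (guard q ι b R).sem δ]
    simp only [sem_guard]
    rw [sum_conjTranspose_guardedOp_mul_guardedOp]
    · have hone : (1 : Op B (guard q ι b R).qvar)
          = ∑ i, (cyl (subset_qvar_guard q b R) (ketbra (b i)))ᴴ
            * cyl (subset_qvar_guard q b R) (ketbra (b i)) := by
        rw [← cyl_one (subset_qvar_guard q b R), ← sum_ketbra b]
        simp only [cyl_sum, ← cyl_conjTranspose, ← cyl_mul, conjTranspose_ketbra,
          ketbra_mul_ketbra, if_true]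
      rw [hone, ← Finset.sum_sub_distrib]
      exact Matrix.posSemidef_sum _ fun i _ =>
        lift (R i) (ih i (hP.2 i)) _ (qvar_subset_guard q b R i) _
    -- Each projection commutes past its branch operator, which brings the two orthogonal
    -- projections together.
    · intro i j hij s t
      rw [← cyl_mul_cyl_comm (subset_qvar_guard q b R) (qvar_subset_guard q b R i) (hP.1 i),
        ← cyl_mul_cyl_comm (subset_qvar_guard q b R) (qvar_subset_guard q b R j) (hP.1 j),
        Matrix.conjTranspose_mul, ← cyl_conjTranspose _ (ketbra _), Matrix.mul_assoc,
        ← Matrix.mul_assoc (cyl _ (ketbra _)ᴴ), ← cyl_mul, conjTranspose_ketbra,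
        ketbra_mul_ketbra, if_neg hij, cyl_zero, Matrix.zero_mul, Matrix.mul_zero]
  | seq P Q ihP ihQ =>
    have h₁ : P.qvar ⊆ (seq P Q).qvar := Finset.subset_union_left
    have h₂ : Q.qvar ⊆ (seq P Q).qvar := Finset.subset_union_right
    have hsum := sum_state_seq P Q fun s t =>
      (cyl h₂ (Q.sem t) * cyl h₁ (P.sem s))ᴴ * (cyl h₂ (Q.sem t) * cyl h₁ (P.sem s))
    have hP' := lift P (ihP hP.2.1) _ h₁ 1
    rw [Matrix.conjTranspose_one, Matrix.one_mul] at hP'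
    have hQ' := Matrix.posSemidef_sum (Finset.univ : Finset P.State) fun s _ =>
      lift Q (ihQ hP.2.2) _ h₂ (cyl h₁ (P.sem s))
    rw [Finset.sum_sub_distrib] at hQ'
    -- The loss in `P` and the loss in `Q` after `P` telescope to the loss in `P; Q`.
    have := hP'.add hQ'
    simp only [Matrix.mul_one, sub_add_sub_cancel] at this
    exact Eq.subst (motive := fun A => (1 - A).PosSemidef) hsum.symm this

theorem qvar_subset_choice (P : Prog B D) {ι : Type} [Fintype ι]
    (b : OrthonormalBasis ι ℂ (Hsp B P.qvar)) (R : ι → Prog B D) :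
    P.qvar ⊆ (choice P b R).qvar :=
  Finset.subset_union_left

theorem branch_subset_choice (P : Prog B D) {ι : Type} [Fintype ι]
    (b : OrthonormalBasis ι ℂ (Hsp B P.qvar)) (R : ι → Prog B D) (i : ι) :
    (R i).qvar ⊆ (choice P b R).qvar :=
  (qvar_subset_guard P.qvar b R i).trans Finset.subset_union_right

/-- Each Kraus operator of the coin program is absorbed on the right of the guard projections, which
gives one guarded sum per classical state of `P`. -/
theorem denote_choice [∀ q, Nonempty (B q)] (P : Prog B D) {ι : Type} [Fintype ι]
    (b : OrthonormalBasis ι ℂ (Hsp B P.qvar)) (R : ι → Prog B D)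
    (ρ : Op B (choice P b R).qvar) :
    (choice P b R).denote ρ = ∑ s : P.State, guardedSum R (branch_subset_choice P b R)
      (fun i => cyl (qvar_subset_choice P b R) (ketbra (b i) * P.sem s)) ρ := by
  classical
  have h₁ : P.qvar ⊆ (choice P b R).qvar := Finset.subset_union_left
  have h₂ : (guard P.qvar ι b R).qvar ⊆ (choice P b R).qvar := Finset.subset_union_right
  refine (sum_state_seq P (guard P.qvar ι b R) fun s t =>
    (cyl h₂ ((guard P.qvar ι b R).sem t) * cyl h₁ (P.sem s)) * ρ *
      (cyl h₂ ((guard P.qvar ι b R).sem t) * cyl h₁ (P.sem s))ᴴ).trans ?_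
  refine Finset.sum_congr rfl fun s _ => ?_
  rw [sum_state_guard P.qvar b R fun t =>
    (cyl h₂ ((guard P.qvar ι b R).sem t) * cyl h₁ (P.sem s)) * ρ *
      (cyl h₂ ((guard P.qvar ι b R).sem t) * cyl h₁ (P.sem s))ᴴ]
  simp only [guardedSum, sem_guard, cyl_guardedOp, guardedOp_mul, cyl_cyl, cyl_mul]

theorem branch_subset_guard_seq_unitary (q : Finset QV) {ι : Type} [Fintype ι]
    (b : OrthonormalBasis ι ℂ (Hsp B q)) (R : ι → Prog B D)
    (U : Matrix.unitaryGroup (Conf B q) ℂ) (i : ι) :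
    (R i).qvar ⊆ ((guard q ι b R).seq (unitary q U)).qvar :=
  (qvar_subset_guard q b R i).trans Finset.subset_union_left

theorem subset_guard_seq_unitary (q : Finset QV) {ι : Type} [Fintype ι]
    (b : OrthonormalBasis ι ℂ (Hsp B q)) (R : ι → Prog B D)
    (U : Matrix.unitaryGroup (Conf B q) ℂ) :
    q ⊆ ((guard q ι b R).seq (unitary q U)).qvar :=
  Finset.subset_union_right

theorem denote_guard_seq_unitary [∀ q, Nonempty (B q)] (q : Finset QV) {ι : Type} [Fintype ι]
    (b : OrthonormalBasis ι ℂ (Hsp B q)) (R : ι → Prog B D)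
    (U : Matrix.unitaryGroup (Conf B q) ℂ) (hd : ∀ i, Disjoint q (R i).qvar)
    (ρ : Op B ((guard q ι b R).seq (unitary q U)).qvar) :
    ((guard q ι b R).seq (unitary q U)).denote ρ =
      guardedSum R (branch_subset_guard_seq_unitary q b R U)
        (fun i => cyl (subset_guard_seq_unitary q b R U) (U.1 * ketbra (b i))) ρ := by
  classical
  have h₁ : (guard q ι b R).qvar ⊆ ((guard q ι b R).seq (unitary q U)).qvar :=
    Finset.subset_union_left
  have h₂ := subset_guard_seq_unitary q b R U
  have e : ∀ δ : (i : ι) → (R i).State,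
      cyl h₂ U.1 * cyl h₁ ((guard q ι b R).sem δ)
        = guardedOp R (branch_subset_guard_seq_unitary q b R U)
          (fun i => cyl h₂ (U.1 * ketbra (b i))) δ := by
    intro δ
    rw [sem_guard, cyl_guardedOp, cyl_mul_guardedOp _ _ _ hd]
    simp only [cyl_cyl, cyl_mul]
  refine (sum_state_seq (guard q ι b R) (unitary q U) fun s _ =>
    (cyl h₂ U.1 * cyl h₁ ((guard q ι b R).sem s)) * ρ *
      (cyl h₂ U.1 * cyl h₁ ((guard q ι b R).sem s))ᴴ).trans ?_
  rw [sum_state_guard q b R fun s => ∑ _t : (unitary q U : Prog B D).State,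
    (cyl h₂ U.1 * cyl h₁ ((guard q ι b R).sem s)) * ρ *
      (cyl h₂ U.1 * cyl h₁ ((guard q ι b R).sem s))ᴴ]
  refine Finset.sum_congr rfl fun δ _ => ?_
  rw [e]
  exact (Fintype.sum_equiv (Equiv.refl PUnit) _ (fun _ => _) fun _ => rfl).trans (by simp)

end Prog

/-! ### A unitary coin -/

/-- Relabelling along an equality of variable sets is a cylindrical extension with nothing added, so
the algebra of `cyl` applies. -/
theorem equivalent_iff_cyl (C C' : Cmd B D) :
    Cmd.Equivalent C C' ↔ ∃ h : C.qvar = C'.qvar, ∀ ρ : Op B C.qvar,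
      C'.denote (cyl h.subset ρ) = cyl h.subset (C.denote ρ) := by
  unfold Cmd.Equivalent
  refine exists_congr fun h => forall_congr' fun ρ => ?_
  rw [cyl_eq_submatrix_of_eq h, cyl_eq_submatrix_of_eq h]

theorem equivalent_choice_unitary [∀ q, Nonempty (B q)] (q : Finset QV)
    (U : Matrix.unitaryGroup (Conf B q) ℂ) (ι : Type) [Fintype ι]
    (b : OrthonormalBasis ι ℂ (Hsp B q)) (R : ι → Prog B D)
    (hd : ∀ i, Disjoint q (R i).qvar) :
    Cmd.Equivalent
      (Cmd.prog (Prog.choice (Prog.unitary q U) b R))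
      (Cmd.prog ((Prog.guard q ι (rotate U⁻¹ b) R).seq (Prog.unitary q U))) := by
  rw [equivalent_iff_cyl]
  have hq : (Prog.choice (Prog.unitary q U : Prog B D) b R).qvar
      = ((Prog.guard q ι (rotate U⁻¹ b) R).seq (Prog.unitary q U)).qvar :=
    Finset.union_comm _ _
  refine ⟨hq, fun ρ => ?_⟩
  refine (Prog.denote_guard_seq_unitary q (rotate U⁻¹ b) R U hd _).trans ?_
  have hX : (fun i => U.1 * ketbra (rotate U⁻¹ b i)) = fun i => ketbra (b i) * U.1 :=
    funext fun i => mul_ketbra_rotate_inv U b i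
  -- The unitary has a single classical state, so the sum over coin states has one term.
  have hT : (Prog.choice (Prog.unitary q U : Prog B D) b R).denote ρ
      = guardedSum R (Prog.branch_subset_choice (Prog.unitary q U) b R)
        (fun i => cyl (Prog.qvar_subset_choice (Prog.unitary q U : Prog B D) b R)
          (ketbra (b i) * U.1)) ρ :=
    (Prog.denote_choice (Prog.unitary q U) b R ρ).trans
      ((Fintype.sum_equiv (Equiv.refl PUnit) (fun _ => _) _ fun _ => rfl).symm.trans
        (Fintype.sum_unique _))
  refine Eq.trans ?_ (congrArg (cyl hq.subset) hT.symm)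
  refine Eq.trans ?_ (cyl_guardedSum_cyl (S := q) hq.subset R _
    (Prog.qvar_subset_choice (Prog.unitary q U : Prog B D) b R) _ ρ).symm
  exact congrArg (fun X : ι → Op B q => guardedSum R
    (Prog.branch_subset_guard_seq_unitary q (rotate U⁻¹ b) R U)
    (fun i => cyl (Prog.subset_guard_seq_unitary q (rotate U⁻¹ b) R U) (X i)) (cyl hq.subset ρ)) hX

/-! ### Marginals of guarded sums -/

theorem guardedSum_congr {T : Finset QV} {ι : Type*} [Fintype ι] {R R' : ι → Prog B D}
    (hR : R = R') (h : ∀ i, (R i).qvar ⊆ T) (h' : ∀ i, (R' i).qvar ⊆ T) (X : ι → Op B T)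
    (ρ : Op B T) : guardedSum R h X ρ = guardedSum R' h' X ρ := by
  subst hR
  rfl

theorem guardedSum_abort {T : Finset QV} {ι : Type*} [Fintype ι]
    (h : ∀ _ : ι, (Prog.abort : Prog B D).qvar ⊆ T) (X : ι → Op B T) (ρ : Op B T) :
    guardedSum (fun _ => (Prog.abort : Prog B D)) h X ρ = 0 := by
  have h₀ : ∀ δ, guardedOp (fun _ => (Prog.abort : Prog B D)) h X δ = 0 := by
    intro δ
    refine Finset.sum_eq_zero fun i _ => ?_
    rw [show (Prog.abort : Prog B D).sem (δ i) = 0 from rfl, cyl_zero, Matrix.zero_mul, smul_zero]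
  simp [guardedSum, h₀]

/-- Removing one point from a grid leaves the other columns entire and column `j` without `i`. The
last factor is the coefficient of branch `i` in the guard of column `j` alone. -/
theorem prod_erase_prod {ι κ M : Type*} [Fintype ι] [Fintype κ] [DecidableEq ι] [DecidableEq κ]
    [CommMonoid M] (f : ι × κ → M) (i : ι) (j : κ) :
    ∏ p ∈ Finset.univ.erase (i, j), f p
      = (∏ l ∈ Finset.univ.erase j, ∏ k, f (k, l)) * ∏ k ∈ Finset.univ.erase i, f (k, j) := by
  have hs : (Finset.univ : Finset (ι × κ)).erase (i, j)
      = (Finset.univ ×ˢ Finset.univ.erase j) ∪ (Finset.univ.erase i ×ˢ {j}) := by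
    ext ⟨k, l⟩
    simp only [Finset.mem_erase, Finset.mem_univ, Finset.mem_union, Finset.mem_product,
      Finset.mem_singleton, Prod.mk.injEq, ne_eq, and_true, true_and]
    tauto
  rw [hs, Finset.prod_union, Finset.prod_product_right, Finset.prod_product_right]
  · simp
  · rw [Finset.disjoint_left]
    rintro ⟨k, l⟩ h₁ h₂
    simp_all

theorem single_mul_conjTranspose_single {n : Type*} [Fintype n] [DecidableEq n] (s t u : n) :
    Matrix.single s t (1 : ℂ) * (Matrix.single u t (1 : ℂ))ᴴ = Matrix.single s u 1 := by
  rw [Matrix.conjTranspose_single]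
  simp

/-- The `(j, k)` term factors as `G j * σ * (G k)ᴴ` times `|e j⟩⟨e k|` on the register, whose trace
vanishes unless `j = k`. -/
theorem ptrace_sum_mul_sum {r T : Finset QV} (hr : r ⊆ T) {J : Type*} [Fintype J]
    (e : J ≃ Conf B r) (s₀ : Conf B r) (G : J → Op B (T \ r)) (σ : Op B (T \ r)) :
    ptrace (r := r)
        ((∑ j, cyl (W := T) Finset.sdiff_subset (G j) * cyl hr (Matrix.single (e j) s₀ 1)) *
          cyl Finset.sdiff_subset σ *
          (∑ j, cyl (W := T) Finset.sdiff_subset (G j) * cyl hr (Matrix.single (e j) s₀ 1))ᴴ)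
      = ∑ j, G j * σ * (G j)ᴴ := by
  classical
  have hd : Disjoint (T \ r) r := Finset.sdiff_disjoint
  have key : ∀ j k,
      (cyl (W := T) Finset.sdiff_subset (G j) * cyl hr (Matrix.single (e j) s₀ (1 : ℂ))) *
        cyl Finset.sdiff_subset σ *
        (cyl (W := T) Finset.sdiff_subset (G k) * cyl hr (Matrix.single (e k) s₀ (1 : ℂ)))ᴴ
      = cyl Finset.sdiff_subset (G j * σ * (G k)ᴴ) *
          cyl hr (Matrix.single (e j) (e k) (1 : ℂ)) := by
    intro j k
    rw [← single_mul_conjTranspose_single (e j) s₀ (e k), cyl_mul, cyl_mul, cyl_mul,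
      Matrix.conjTranspose_mul, cyl_conjTranspose, cyl_conjTranspose]
    generalize hZ : cyl hr (Matrix.single (e j) s₀ (1 : ℂ)) = Z
    rw [← cyl_conjTranspose _ (G k), ← cyl_conjTranspose hr]
    have c₁ : Z * cyl (W := T) Finset.sdiff_subset σ
        = cyl (W := T) Finset.sdiff_subset σ * Z := by
      rw [← hZ, cyl_mul_cyl_comm _ _ hd]
    have c₂ : Z * cyl (W := T) Finset.sdiff_subset (G k)ᴴ
        = cyl (W := T) Finset.sdiff_subset (G k)ᴴ * Z := by
      rw [← hZ, cyl_mul_cyl_comm _ _ hd]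
    rw [← cyl_mul_cyl_comm _ _ hd (G k)ᴴ]
    simp only [Matrix.mul_assoc]
    rw [← Matrix.mul_assoc Z, c₁]
    simp only [Matrix.mul_assoc]
    rw [← Matrix.mul_assoc Z, c₂]
    simp only [Matrix.mul_assoc]
  rw [Matrix.conjTranspose_sum, Finset.sum_mul, Finset.sum_mul, ptrace_sum]
  refine Finset.sum_congr rfl fun j _ => ?_
  rw [Finset.mul_sum, ptrace_sum, Finset.sum_eq_single j]
  · rw [key, ptrace_cyl_mul_cyl, Matrix.trace_single_eq_same, one_smul]
  · intro k _ hk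
    rw [key, ptrace_cyl_mul_cyl, Matrix.trace_single_eq_of_ne _ _ _ fun h => hk (e.injective h).symm,
      zero_smul]
  · simp

/-- By `hX`, on the initial register state `s₀` the guard `(i, j)` writes `e j` into the register,
so the partial trace separates the columns. In column `j` the states of the other columns enter only
through normalised weights and are summed out. -/
theorem ptrace_guardedSum [∀ q, Nonempty (B q)] {r T : Finset QV} (hr : r ⊆ T)
    {ι J : Type*} [Fintype ι] [Fintype J] (e : J ≃ Conf B r) (s₀ : Conf B r)
    (Q : ι × J → Prog B D) (hQ : ∀ p, (Q p).qvar ⊆ T \ r) (hQT : ∀ p, (Q p).qvar ⊆ T)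
    (X : ι × J → Op B T) (Y : ι × J → Op B (T \ r))
    (hX : ∀ i j, X (i, j) * cyl hr (Matrix.single s₀ s₀ 1)
      = cyl Finset.sdiff_subset (Y (i, j)) * cyl hr (Matrix.single (e j) s₀ 1))
    (σ : Op B (T \ r)) :
    ptrace (guardedSum Q hQT X (cyl Finset.sdiff_subset σ * cyl hr (Matrix.single s₀ s₀ 1)))
      = ∑ j, guardedSum (fun i => Q (i, j)) (fun i => hQ (i, j)) (fun i => Y (i, j)) σ := by
  classical
  let G (j : J) (x : (i : ι) → (Q (i, j)).State) : Op B (T \ r) :=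
    guardedOp (fun i => Q (i, j)) (fun i => hQ (i, j)) (fun i => Y (i, j)) x
  let a (δ : (p : ι × J) → (Q p).State) (j : J) : ℂ :=
    ∏ l ∈ Finset.univ.erase j, ∏ k, (coef (Q (k, l)).sem (δ (k, l)) : ℂ)
  have ha : ∀ δ j, star (a δ j) = a δ j := by
    intro δ j
    simp [a]
  have hop : ∀ δ : (p : ι × J) → (Q p).State,
      guardedOp Q hQT X δ * cyl hr (Matrix.single s₀ s₀ 1)
        = ∑ j, cyl Finset.sdiff_subset (a δ j • G j fun i => δ (i, j)) *
          cyl hr (Matrix.single (e j) s₀ 1) := by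
    intro δ
    rw [guardedOp_mul, guardedOp_eq_sum, Fintype.sum_prod_type_right]
    refine Finset.sum_congr rfl fun j _ => ?_
    simp only [G, cyl_smul, cyl_guardedOp, hX]
    rw [guardedOp_eq_sum, Finset.smul_sum, Finset.sum_mul]
    refine Finset.sum_congr rfl fun i _ => ?_
    rw [smul_smul, Matrix.smul_mul, Matrix.mul_assoc, prod_erase_prod]
    simp [a]
  have hterm : ∀ δ : (p : ι × J) → (Q p).State,
      ptrace (guardedOp Q hQT X δ *
          (cyl Finset.sdiff_subset σ * cyl hr (Matrix.single s₀ s₀ 1)) *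
          (guardedOp Q hQT X δ)ᴴ)
        = ∑ j, (a δ j * a δ j) • (G j (fun i => δ (i, j)) * σ * (G j fun i => δ (i, j))ᴴ) := by
    intro δ
    -- The projector `|s₀⟩⟨s₀|` is doubled so that one copy meets the Kraus operator and one its
    -- adjoint.
    have hZ : cyl (W := T) Finset.sdiff_subset σ * cyl hr (Matrix.single s₀ s₀ (1 : ℂ))
        = cyl hr (Matrix.single s₀ s₀ (1 : ℂ)) * cyl Finset.sdiff_subset σ *
          (cyl hr (Matrix.single s₀ s₀ (1 : ℂ)))ᴴ := by
      rw [← cyl_mul_cyl_comm _ _ Finset.sdiff_disjoint, Matrix.mul_assoc, ← cyl_conjTranspose,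
        ← cyl_mul, single_mul_conjTranspose_single]
    have hS : guardedOp Q hQT X δ *
          (cyl Finset.sdiff_subset σ * cyl hr (Matrix.single s₀ s₀ 1)) * (guardedOp Q hQT X δ)ᴴ
        = (guardedOp Q hQT X δ * cyl hr (Matrix.single s₀ s₀ 1)) * cyl Finset.sdiff_subset σ *
          (guardedOp Q hQT X δ * cyl hr (Matrix.single s₀ s₀ 1))ᴴ := by
      rw [hZ, Matrix.conjTranspose_mul]
      simp only [Matrix.mul_assoc]
    rw [hS, hop, ptrace_sum_mul_sum]
    refine Finset.sum_congr rfl fun j _ => ?_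
    rw [Matrix.conjTranspose_smul, ha, Matrix.smul_mul, Matrix.smul_mul, Matrix.mul_smul, smul_smul]
  rw [guardedSum_eq_sum, ptrace_sum]
  simp only [hterm]
  rw [Finset.sum_comm]
  refine Finset.sum_congr rfl fun j _ => ?_
  -- States are regrouped by columns, each column becoming one coordinate of `sum_pi_marginal`.
  let E : ((p : ι × J) → (Q p).State) ≃ ((l : J) → (i : ι) → (Q (i, l)).State) :=
    { toFun := fun δ l i => δ (i, l)
      invFun := fun x p => x p.2 p.1
      left_inv := fun _ => rfl
      right_inv := fun _ => rfl }
  have hf : ∀ l : J, ∑ x : (i : ι) → (Q (i, l)).State,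
      ∏ k, ((coef (Q (k, l)).sem (x k) ^ 2 : ℝ) : ℂ) = 1 := by
    intro l
    have := Finset.prod_univ_sum (fun i : ι => (Finset.univ : Finset (Q (i, l)).State))
      (fun k s => ((coef (Q (k, l)).sem s ^ 2 : ℝ) : ℂ))
    rw [Fintype.piFinset_univ] at this
    rw [← this]
    refine Finset.prod_eq_one fun k _ => ?_
    have := (Q (k, l)).nonempty_state
    rw [← Complex.ofReal_sum, sum_coef_sq, Complex.ofReal_one]
  rw [guardedSum_eq_sum]
  refine (Fintype.sum_equiv E _ (fun x => (∏ l ∈ Finset.univ.erase j,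
    ∏ k, ((coef (Q (k, l)).sem (x l k) ^ 2 : ℝ) : ℂ)) • (G j (x j) * σ * (G j (x j))ᴴ))
    fun δ => ?_).trans (sum_pi_marginal
      (fun l (x : (i : ι) → (Q (i, l)).State) => ∏ k, ((coef (Q (k, l)).sem (x k) ^ 2 : ℝ) : ℂ))
      hf j (fun x => G j x * σ * (G j x)ᴴ))
  congr 1
  simp only [a, ← Finset.prod_mul_distrib]
  simp [E, sq]

/-! ### Unitary dilation -/

/-- Configurations of a disjoint union as pairs of configurations. -/
def confUnion {q r : Finset QV} (hd : Disjoint q r) :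
    Conf B (q ∪ r) ≃ Conf B q × Conf B r where
  toFun c := (Finset.restrict₂ (π := B) Finset.subset_union_left c,
    Finset.restrict₂ (π := B) Finset.subset_union_right c)
  invFun p x := if hx : x.1 ∈ q then p.1 ⟨x.1, hx⟩
    else p.2 ⟨x.1, (Finset.mem_union.1 x.2).resolve_left hx⟩
  left_inv c := by
    ext x
    by_cases hx : x.1 ∈ q <;> simp [hx, Finset.restrict₂]
  right_inv p := by
    ext x
    · simp [Finset.restrict₂]
    · have := Finset.disjoint_right.1 hd x.2
      simp [Finset.restrict₂, this]

theorem cyl_single_self {r W : Finset QV} (h : r ⊆ W) (s : Conf B r) :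
    cyl h (Matrix.single s s (1 : ℂ)) = Matrix.diagonal fun c =>
      if Finset.restrict₂ (π := B) h c = s then 1 else 0 := by
  ext c c'
  by_cases hc : c = c'
  · subst hc
    simp [cyl, Matrix.single_apply, eq_comm]
  · rw [Matrix.diagonal_apply_ne _ hc]
    simp only [cyl, Matrix.single_apply]
    split_ifs with h₁ h₂
    · exact absurd ((confSplit h).injective (Prod.ext (h₂.1.symm.trans h₂.2) h₁)) hc
    all_goals rfl

theorem cyl_mul_cyl_union_apply {q r : Finset QV} (hd : Disjoint q r) (A : Op B q) (C : Op B r)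
    (c c' : Conf B (q ∪ r)) :
    (cyl Finset.subset_union_left A * cyl Finset.subset_union_right C : Op B (q ∪ r)) c c'
      = A (Finset.restrict₂ (π := B) Finset.subset_union_left c)
          (Finset.restrict₂ (π := B) Finset.subset_union_left c')
        * C (Finset.restrict₂ (π := B) Finset.subset_union_right c)
          (Finset.restrict₂ (π := B) Finset.subset_union_right c') := by
  rw [cyl_mul_cyl_apply _ _ hd, if_pos]
  rw [restrict₂_eq_iff]
  simp

theorem finrank_hsp (V : Finset QV) :
    Module.finrank ℂ (Hsp B V) = Fintype.card (Conf B V) :=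
  finrank_euclideanSpace

theorem inner_eq_sum_confUnion {q r : Finset QV} (hd : Disjoint q r) (x y : Hsp B (q ∪ r)) :
    inner ℂ x y = ∑ s : Conf B r, ∑ a : Conf B q,
      y ((confUnion hd).symm (a, s)) * star (x ((confUnion hd).symm (a, s))) := by
  rw [EuclideanSpace.inner_eq_star_dotProduct, dotProduct, ← Fintype.sum_prod_type_right'
    fun a s => y ((confUnion hd).symm (a, s)) * star (x ((confUnion hd).symm (a, s)))]
  exact ((confUnion hd).symm.sum_comp fun c => y c * star (x c)).symm

theorem _root_.OrthonormalBasis.matrixOf_mem_unitaryGroup {n : Type*} [Fintype n]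
    [DecidableEq n] (b : OrthonormalBasis n ℂ (EuclideanSpace ℂ n)) :
    Matrix.of (fun i j => b j i) ∈ Matrix.unitaryGroup n ℂ := by
  rw [Matrix.mem_unitaryGroup_iff']
  ext i j
  have := b.inner_eq_ite i j
  rw [EuclideanSpace.inner_eq_star_dotProduct, dotProduct_comm] at this
  rw [Matrix.one_apply, ← this]
  rfl

/-- These are the columns of `|a⟩|s₀⟩ ↦ ∑ s, (L s |a⟩)|s⟩`; the hypothesis `hL` says that this map
is an isometry. -/
theorem orthonormal_kraus {q r : Finset QV} (hd : Disjoint q r)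
    (L : Conf B r → Op B q) (hL : ∑ s, (L s)ᴴ * L s = 1) (s₀ : Conf B r) :
    Orthonormal ℂ ({c | (confUnion hd c).2 = s₀}.domRestrict fun c =>
      (WithLp.toLp 2 fun c' => L (confUnion hd c').2 (confUnion hd c').1 (confUnion hd c).1 :
        Hsp B (q ∪ r))) := by
  classical
  rw [orthonormal_iff_ite]
  rintro ⟨c, hc⟩ ⟨d, hd'⟩
  have hinner : ∑ s : Conf B r, ∑ a : Conf B q,
      L s a (confUnion hd d).1 * star (L s a (confUnion hd c).1)
      = (1 : Op B q) (confUnion hd c).1 (confUnion hd d).1 := by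
    rw [← hL, Matrix.sum_apply]
    refine Finset.sum_congr rfl fun s _ => ?_
    rw [Matrix.mul_apply]
    exact Finset.sum_congr rfl fun x _ => mul_comm _ _
  rw [Set.domRestrict_apply, Set.domRestrict_apply, inner_eq_sum_confUnion hd]
  simp only [Equiv.apply_symm_apply]
  rw [hinner, Matrix.one_apply]
  simp only [Subtype.mk.injEq]
  refine if_congr ⟨fun h => (confUnion hd).injective (Prod.ext h (hc.trans hd'.symm)), fun h => ?_⟩
    rfl rfl
  rw [h]

theorem exists_unitary_of_sum_eq_one {q r : Finset QV} (hd : Disjoint q r)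
    (L : Conf B r → Op B q) (hL : ∑ s, (L s)ᴴ * L s = 1) (s₀ : Conf B r) :
    ∃ U : Matrix.unitaryGroup (Conf B (q ∪ r)) ℂ, ∀ s,
      cyl Finset.subset_union_right (Matrix.single s s 1) * (U : Op B (q ∪ r)) *
          cyl Finset.subset_union_right (Matrix.single s₀ s₀ 1)
        = cyl Finset.subset_union_left (L s) *
          cyl Finset.subset_union_right (Matrix.single s s₀ 1) := by
  have hfin : Module.finrank ℂ (Hsp B (q ∪ r)) = Fintype.card (Conf B (q ∪ r)) := finrank_hsp _
  -- Only the columns with register value `s₀` are prescribed; the rest of the unitary is an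
  -- arbitrary completion.
  obtain ⟨b, hb⟩ := (orthonormal_kraus hd L hL s₀).exists_orthonormalBasis_extension_of_card_eq hfin
  have hU := b.matrixOf_mem_unitaryGroup
  have hb' : ∀ c c', (confUnion hd c').2 = s₀ → Matrix.of (fun i j => b j i) c c'
      = L (confUnion hd c).2 (confUnion hd c).1 (confUnion hd c').1 := fun c c' h => by
    rw [Matrix.of_apply, hb c' h]
  clear hb
  generalize Matrix.of (fun i j => b j i) = U at hU hb'
  refine ⟨⟨U, hU⟩, fun s => ?_⟩
  ext c c'
  rw [cyl_single_self, cyl_single_self, Matrix.mul_diagonal, Matrix.diagonal_mul,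
    cyl_mul_cyl_union_apply hd, Matrix.single_apply]
  by_cases h₁ : Finset.restrict₂ (π := B) (Finset.subset_union_right (s₁ := q)) c = s
  · by_cases h₂ : Finset.restrict₂ (π := B) (Finset.subset_union_right (s₁ := q)) c' = s₀
    · rw [if_pos h₁, if_pos h₂, if_pos ⟨h₁.symm, h₂.symm⟩, one_mul, mul_one, mul_one, ← h₁]
      exact hb' c c' h₂
    · rw [if_neg h₂, if_neg (mt And.right (Ne.symm h₂)), mul_zero, mul_zero]
  · rw [if_neg h₁, if_neg (mt And.left (Ne.symm h₁)), zero_mul, zero_mul, mul_zero]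

theorem exists_dilation {q r : Finset QV} (hd : Disjoint q r) {Δ : Type*} [Fintype Δ]
    (K : Δ → Op B q) (hK : (1 - ∑ δ, (K δ)ᴴ * K δ).PosSemidef)
    (hcard : Fintype.card Δ < Fintype.card (Conf B r)) :
    ∃ (f : Δ ↪ Conf B r) (s₀ : Conf B r) (L : Conf B r → Op B q)
      (U : Matrix.unitaryGroup (Conf B (q ∪ r)) ℂ), (∀ δ, L (f δ) = K δ) ∧ ∀ s,
      cyl Finset.subset_union_right (Matrix.single s s 1) * (U : Op B (q ∪ r)) *
          cyl Finset.subset_union_right (Matrix.single s₀ s₀ 1)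
        = cyl Finset.subset_union_left (L s) *
          cyl Finset.subset_union_right (Matrix.single s s₀ 1) := by
  obtain ⟨C, hC⟩ := hK.exists_eq_conjTranspose_mul_self
  -- The strict inequality leaves one label, `none`, for the operator `C` that completes the Kraus
  -- family.
  obtain ⟨g⟩ : Nonempty (Option Δ ↪ Conf B r) :=
    Function.Embedding.nonempty_of_card_le (by rw [Fintype.card_option]; exact hcard)
  let L : Conf B r → Op B q := Function.extend g (fun o => o.elim C K) 0
  have hLg : ∀ o, L (g o) = o.elim C K := fun o => g.injective.extend_apply _ _ o
  have hL : ∑ s, (L s)ᴴ * L s = 1 := by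
    rw [← Fintype.sum_of_injective g g.injective
      (fun o => (o.elim C K)ᴴ * o.elim C K) (fun s => (L s)ᴴ * L s)]
    · rw [Fintype.sum_option]
      exact (congrArg (· + ∑ δ, (K δ)ᴴ * K δ) hC.symm).trans (sub_add_cancel _ _)
    · intro s hs
      have : L s = 0 := Function.extend_apply' _ _ _ hs
      rw [this, Matrix.mul_zero]
    · intro o
      rw [hLg]
  -- Any label could serve as the initial register value; `g none` is at hand.
  obtain ⟨U, hU⟩ := exists_unitary_of_sum_eq_one hd L hL (g none)
  exact ⟨Function.Embedding.some.trans g, g none, L, U, fun δ => hLg (some δ), hU⟩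

theorem exists_product_basis {q r : Finset QV} (hd : Disjoint q r) {ι J : Type*} [Fintype ι]
    [Fintype J] (b : OrthonormalBasis ι ℂ (Hsp B q)) (e : J ≃ Conf B r) :
    ∃ ψ : OrthonormalBasis (ι × J) ℂ (Hsp B (q ∪ r)), ∀ i j,
      ketbra (ψ (i, j)) = cyl Finset.subset_union_left (ketbra (b i)) *
        cyl Finset.subset_union_right (Matrix.single (e j) (e j) 1) := by
  classical
  let v (p : ι × J) : Hsp B (q ∪ r) := WithLp.toLp 2 fun c =>
    b p.1 (confUnion hd c).1 * if (confUnion hd c).2 = e p.2 then 1 else 0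
  have hv : Orthonormal ℂ ((Set.univ : Set (ι × J)).domRestrict v) := by
    rw [orthonormal_iff_ite]
    rintro ⟨⟨i, j⟩, _⟩ ⟨⟨k, l⟩, _⟩
    have hik := b.inner_eq_ite i k
    rw [EuclideanSpace.inner_eq_star_dotProduct, dotProduct] at hik
    rw [Set.domRestrict_apply, Set.domRestrict_apply, inner_eq_sum_confUnion hd, Finset.sum_comm]
    have : ∀ x : Conf B q, ∑ s : Conf B r,
        v (k, l) ((confUnion hd).symm (x, s)) * star (v (i, j) ((confUnion hd).symm (x, s)))
        = (b k x * star (b i x)) * if j = l then 1 else 0 := by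
      intro x
      simp only [v, Equiv.apply_symm_apply]
      rw [Finset.sum_eq_single (e l)]
      · by_cases hjl : j = l
        · simp [hjl]
        · simp [hjl, Ne.symm hjl]
      · intro s _ hs
        simp [hs]
      · simp
    simp only [this]
    rw [← Finset.sum_mul]
    refine (congrArg (· * _) hik).trans ?_
    by_cases h₁ : i = k <;> by_cases h₂ : j = l <;> simp [h₁, h₂]
  have hcard : Module.finrank ℂ (Hsp B (q ∪ r)) = Fintype.card (ι × J) := by
    rw [finrank_hsp, Fintype.card_congr (confUnion hd), Fintype.card_prod, Fintype.card_prod,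
      Fintype.card_congr e, ← finrank_hsp q, Module.finrank_eq_card_basis b.toBasis]
  -- The orthonormal family already has as many members as the dimension, so extending it from all
  -- of `ι × J` leaves it unchanged.
  obtain ⟨ψ, hψ⟩ := hv.exists_orthonormalBasis_extension_of_card_eq hcard
  refine ⟨ψ, fun i j => ?_⟩
  ext c c'
  rw [cyl_mul_cyl_union_apply hd, hψ _ (Set.mem_univ _)]
  have hv' : ∀ c, v (i, j) c = b i (Finset.restrict₂ (π := B) Finset.subset_union_left c) *
      if e j = Finset.restrict₂ (π := B) Finset.subset_union_right c then 1 else 0 := fun c =>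
    congrArg (_ * ·) (if_congr eq_comm rfl rfl)
  simp only [ketbra, Matrix.vecMulVec_apply, Matrix.single_apply, hv', Pi.star_apply]
  by_cases h₁ : e j = Finset.restrict₂ (π := B) (Finset.subset_union_right (s₁ := q)) c
  · by_cases h₂ : e j = Finset.restrict₂ (π := B) (Finset.subset_union_right (s₁ := q)) c'
    · rw [if_pos h₁, if_pos h₂, if_pos ⟨h₁, h₂⟩]
      simp
    · rw [if_neg h₂]
      simp [h₂]
  · rw [if_neg h₁]
    simp [h₁]

/-- A register of `n` fresh variables has dimension at least `2 ^ n`, which exceeds `n`. -/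
theorem exists_fresh (hB : {x : QV | Nontrivial (B x)}.Infinite) (S : Finset QV) (n : ℕ) :
    ∃ r : Finset QV, Disjoint r S ∧ n < Fintype.card (Conf B r) := by
  obtain ⟨r, hr, hn⟩ := (hB.sdiff S.finite_toSet).exists_subset_card_eq n
  refine ⟨r, Finset.disjoint_left.2 fun x hx hS => (hr hx).2 hS, ?_⟩
  have h : ∀ x ∈ (Finset.univ : Finset r), 2 ≤ Fintype.card (B x) := fun x _ => by
    have : Nontrivial (B x) := (hr x.2).1
    exact Fintype.one_lt_card
  have := Finset.prod_le_prod' h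
  rw [Finset.prod_const, Finset.card_univ, Fintype.card_coe, hn] at this
  rw [Fintype.card_pi]
  exact n.lt_two_pow_self.trans_le this

/-! ### A coin program with local variables -/

theorem ptrace_denote_guard_seq_unitary [∀ q, Nonempty (B q)] {q r : Finset QV}
    {ι J : Type} [Fintype ι] [Fintype J] (b : OrthonormalBasis ι ℂ (Hsp B q))
    (e : J ≃ Conf B r) (s₀ : Conf B r) (L : Conf B r → Op B q)
    (U : Matrix.unitaryGroup (Conf B (q ∪ r)) ℂ) (ψ : OrthonormalBasis (ι × J) ℂ (Hsp B (q ∪ r)))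
    (hU : ∀ s, cyl Finset.subset_union_right (Matrix.single s s 1) * (U : Op B (q ∪ r)) *
          cyl Finset.subset_union_right (Matrix.single s₀ s₀ 1)
        = cyl Finset.subset_union_left (L s) *
          cyl Finset.subset_union_right (Matrix.single s s₀ 1))
    (hψ : ∀ i j, ketbra (ψ (i, j)) = cyl Finset.subset_union_left (ketbra (b i)) *
        cyl Finset.subset_union_right (Matrix.single (e j) (e j) 1))
    (Q : ι × J → Prog B D) (hQ : ∀ p, Disjoint (q ∪ r) (Q p).qvar)
    (hr : r ⊆ ((Prog.guard (q ∪ r) (ι × J) (rotate U⁻¹ ψ) Q).seq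
      (Prog.unitary (q ∪ r) U)).qvar)
    (hq : q ⊆ ((Prog.guard (q ∪ r) (ι × J) (rotate U⁻¹ ψ) Q).seq
      (Prog.unitary (q ∪ r) U)).qvar \ r)
    (hQr : ∀ p, (Q p).qvar ⊆ ((Prog.guard (q ∪ r) (ι × J) (rotate U⁻¹ ψ) Q).seq
      (Prog.unitary (q ∪ r) U)).qvar \ r)
    (σ : Op B (((Prog.guard (q ∪ r) (ι × J) (rotate U⁻¹ ψ) Q).seq
      (Prog.unitary (q ∪ r) U)).qvar \ r)) :
    ptrace (((Prog.guard (q ∪ r) (ι × J) (rotate U⁻¹ ψ) Q).seq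
        (Prog.unitary (q ∪ r) U)).denote (tensor hr σ (Matrix.single s₀ s₀ 1)))
      = ∑ j, guardedSum (fun i => Q (i, j)) (fun i => hQr (i, j))
        (fun i => cyl hq (ketbra (b i) * L (e j))) σ := by
  rw [Prog.denote_guard_seq_unitary _ _ _ _ hQ, tensor_eq_cyl_mul_cyl]
  refine ptrace_guardedSum hr e s₀ Q hQr _ _ (fun p => cyl hq (ketbra (b p.1) * L (e p.2)))
    (fun i j => ?_) σ
  have hqr := Prog.subset_guard_seq_unitary (q ∪ r) (rotate U⁻¹ ψ) Q U
  have h₁ : ∀ A : Op B r, cyl hr A = cyl hqr (cyl Finset.subset_union_right A) := fun A =>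
    (cyl_cyl _ _ _).symm
  -- The rotated projection becomes `|i⟩⟨i| ⊗ |e j⟩⟨e j|` followed by `U`, and the block of `U`
  -- between `e j` and `s₀` is `L (e j)`.
  rw [cyl_cyl, ← cyl_cyl Finset.subset_union_left hqr, h₁, h₁, ← cyl_mul, ← cyl_mul,
    mul_ketbra_rotate_inv, hψ, cyl_mul _ (ketbra (b i)) (L (e j)), Matrix.mul_assoc _ _ U.1,
    Matrix.mul_assoc _ _ (cyl _ (Matrix.single s₀ s₀ 1)), hU, Matrix.mul_assoc]

theorem exists_equivalent_block [∀ q, Nonempty (B q)]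
    (hB : {x : QV | Nontrivial (B x)}.Infinite) (P : Prog B D) (ι : Type) [Fintype ι]
    (b : OrthonormalBasis ι ℂ (Hsp B P.qvar)) (R : ι → Prog B D)
    (hWF : (Prog.choice P b R).WF) :
    ∃ (r : Finset QV) (φ₀ : Hsp B r) (hφ₀ : ‖φ₀‖ = 1) (J : Type) (_ : Fintype J)
      (ψ : OrthonormalBasis (ι × J) ℂ (Hsp B (P.qvar ∪ r))) (Q : ι × J → Prog B D)
      (U : Matrix.unitaryGroup (Conf B (P.qvar ∪ r)) ℂ)
      (hr : r ⊆ ((Prog.guard (P.qvar ∪ r) (ι × J) ψ Q).seq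
        (Prog.unitary (P.qvar ∪ r) U)).qvar),
      Disjoint r (Prog.choice P b R).qvar ∧
      (∀ i j, Q (i, j) = R i ∨ Q (i, j) = Prog.abort) ∧
      (Cmd.block r (DensityOp.pure φ₀ hφ₀)
        ((Prog.guard (P.qvar ∪ r) (ι × J) ψ Q).seq (Prog.unitary (P.qvar ∪ r) U)) hr).WF ∧
      Cmd.Equivalent
        (Cmd.prog (Prog.choice P b R))
        (Cmd.block r (DensityOp.pure φ₀ hφ₀)
          ((Prog.guard (P.qvar ∪ r) (ι × J) ψ Q).seq (Prog.unitary (P.qvar ∪ r) U)) hr) := by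
  classical
  obtain ⟨_, hP, hqR, hR⟩ := hWF
  obtain ⟨r, hrS, hcard⟩ := exists_fresh hB (Prog.choice P b R).qvar (Fintype.card P.State)
  have hqr : Disjoint P.qvar r := (hrS.mono_right (Prog.qvar_subset_choice P b R)).symm
  have hrR : ∀ i, Disjoint r (R i).qvar := fun i =>
    hrS.mono_right (Prog.branch_subset_choice P b R i)
  obtain ⟨f, s₀, L, U, hLf, hU⟩ :=
    exists_dilation hqr P.sem (P.posSemidef_one_sub_sum_sem hP) hcard
  -- Guards are indexed in `Type`, while `Conf B r` may live in a higher universe, so its elements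
  -- are numbered.
  let e : Fin (Fintype.card (Conf B r)) ≃ Conf B r := (Fintype.equivFin _).symm
  obtain ⟨ψ, hψ⟩ := exists_product_basis hqr b e
  -- Labels that carry no Kraus operator of `P`, including that of the completing operator, are
  -- blocked by `abort`.
  let Q : ι × Fin (Fintype.card (Conf B r)) → Prog B D := fun p =>
    if ∃ s, f s = e p.2 then R p.1 else Prog.abort
  have hQR : ∀ i j, Q (i, j) = R i ∨ Q (i, j) = Prog.abort := fun i j => by
    by_cases h : ∃ s, f s = e j <;> simp [Q, h]
  have hQf : ∀ s i, Q (i, e.symm (f s)) = R i := fun s i => if_pos ⟨s, by simp⟩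
  have hQsub : ∀ p, (Q p).qvar ⊆ (R p.1).qvar := by
    rintro ⟨i, j⟩
    rcases hQR i j with h | h <;> rw [h]
    exact Finset.empty_subset _
  have hdQ : ∀ p, Disjoint (P.qvar ∪ r) (Q p).qvar := fun p =>
    (Finset.disjoint_union_left.2 ⟨hqR p.1, hrR p.1⟩).mono_right (hQsub p)
  let W : Prog B D := (Prog.guard (P.qvar ∪ r) (ι × Fin (Fintype.card (Conf B r)))
    (rotate U⁻¹ ψ) Q).seq (Prog.unitary (P.qvar ∪ r) U)
  have hqrW : P.qvar ∪ r ⊆ W.qvar := Finset.subset_union_right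
  have hrW : r ⊆ W.qvar := Finset.subset_union_right.trans hqrW
  have hT : (Prog.choice P b R).qvar = W.qvar \ r := by
    have hW : W.qvar = (Prog.choice P b R).qvar ∪ r := by
      apply Finset.Subset.antisymm
      · refine Finset.union_subset (Finset.union_subset ?_ (Finset.biUnion_subset.2 ?_)) ?_
        · exact Finset.union_subset_union_left (Prog.qvar_subset_choice P b R)
        · exact fun p _ => (hQsub p).trans ((Prog.branch_subset_choice P b R p.1).trans
            Finset.subset_union_left)
        · exact Finset.union_subset_union_left (Prog.qvar_subset_choice P b R)
      · refine Finset.union_subset (Finset.union_subset ?_ (Finset.union_subset ?_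
          (Finset.biUnion_subset.2 fun i _ => ?_))) hrW
        · exact Finset.subset_union_left.trans hqrW
        · exact Finset.subset_union_left.trans hqrW
        -- Every `R i` must occur in some column, as otherwise its variables could be lost from the
        -- block; one classical state of `P` suffices.
        · obtain ⟨s⟩ := P.nonempty_state
          rw [← hQf s i]
          exact Prog.branch_subset_guard_seq_unitary (P.qvar ∪ r) (rotate U⁻¹ ψ) Q U _
    rw [hW, Finset.union_sdiff_right, Finset.sdiff_eq_self_of_disjoint hrS.symm]
  have hqT : P.qvar ⊆ W.qvar \ r := (Prog.qvar_subset_choice P b R).trans hT.subset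
  have hRT : ∀ i, (R i).qvar ⊆ W.qvar \ r := fun i =>
    (Prog.branch_subset_choice P b R i).trans hT.subset
  have hφ₀ : ‖(EuclideanSpace.single s₀ 1 : Hsp B r)‖ = 1 := by simp
  have hket : ketbra (EuclideanSpace.single s₀ 1 : Hsp B r) = Matrix.single s₀ s₀ 1 := by
    ext c c'
    by_cases h₁ : c = s₀ <;> by_cases h₂ : c' = s₀ <;>
      simp [ketbra, Matrix.vecMulVec_apply, h₁, h₂, @eq_comm _ s₀]
  refine ⟨r, EuclideanSpace.single s₀ 1, hφ₀, Fin (Fintype.card (Conf B r)), inferInstance,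
    rotate U⁻¹ ψ, Q, U, hrW, hrS, hQR, ⟨?_, ⟨hdQ, ?_⟩, trivial⟩, ?_⟩
  · exact Set.disjoint_empty _
  · rintro ⟨i, j⟩
    rcases hQR i j with h | h <;> rw [h]
    · exact hR i
    · trivial
  rw [equivalent_iff_cyl]
  refine ⟨hT, fun ρ => ?_⟩
  have hblock := ptrace_denote_guard_seq_unitary b e s₀ L U ψ hU hψ Q hdQ hrW hqT
    (fun p => (hQsub p).trans (hRT p.1)) (cyl hT.subset ρ)
  refine (congrArg (fun A => ptrace (W.denote (tensor hrW (cyl hT.subset ρ) A))) hket).trans ?_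
  refine hblock.trans ?_
  refine Eq.trans ?_ (congrArg (cyl hT.subset) (Prog.denote_choice P b R ρ)).symm
  rw [cyl_sum]
  symm
  -- Columns in the image of `f` match the classical states of `P`; all other columns consist of
  -- `abort` and contribute 0.
  refine Fintype.sum_of_injective (fun s => e.symm (f s)) (e.symm.injective.comp f.injective) _ _
    ?_ ?_
  · intro j hj
    have hQj : (fun i => Q (i, j)) = fun _ => Prog.abort :=
      funext fun i => if_neg fun ⟨s, hs⟩ => hj ⟨s, by simp [hs]⟩
    exact (guardedSum_congr hQj _ (fun _ => Finset.empty_subset _) _ _).trans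
      (guardedSum_abort _ _ _)
  · intro s
    refine (cyl_guardedSum_cyl hT.subset R _ _ _ ρ).trans ?_
    simp only [Equiv.apply_symm_apply, hLf]
    exact guardedSum_congr (funext fun i => (hQf s i).symm) _ _ _ _

end QGCL

open QGCL in
/-- Moving the coin of a quantum choice to the end of a guarded command: first for a unitary coin
`U[q]`, then for an arbitrary coin program `P`, with the help of fresh local variables `r`. In the
second part, infinitely many quantum variables are supposed to have a state space of dimension at
least two, so that there are enough fresh variables. -/
theorem mainTheorem1 {QV CV : Type*} [DecidableEq QV]
    {B : QV → Type*} [∀ q, Fintype (B q)] [∀ q, DecidableEq (B q)] [∀ q, Nonempty (B q)]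
    {D : CV → Type*} :
    (∀ (q : Finset QV) (U : Matrix.unitaryGroup (Conf B q) ℂ) (ι : Type) [Fintype ι]
        (b : OrthonormalBasis ι ℂ (Hsp B q)) (R : ι → Prog B D),
        (Prog.choice (Prog.unitary q U) b R).WF →
        (Cmd.prog ((Prog.guard q ι (rotate U⁻¹ b) R).seq (Prog.unitary q U))).WF ∧
        Cmd.Equivalent
          (Cmd.prog (Prog.choice (Prog.unitary q U) b R))
          (Cmd.prog ((Prog.guard q ι (rotate U⁻¹ b) R).seq (Prog.unitary q U)))) ∧
    ({x : QV | Nontrivial (B x)}.Infinite →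
      ∀ (P : Prog B D) (ι : Type) [Fintype ι] (b : OrthonormalBasis ι ℂ (Hsp B P.qvar))
        (R : ι → Prog B D),
        (Prog.choice P b R).WF →
        ∃ (r : Finset QV) (φ₀ : Hsp B r) (hφ₀ : ‖φ₀‖ = 1) (J : Type) (_ : Fintype J)
          (ψ : OrthonormalBasis (ι × J) ℂ (Hsp B (P.qvar ∪ r))) (Q : ι × J → Prog B D)
          (U : Matrix.unitaryGroup (Conf B (P.qvar ∪ r)) ℂ)
          (hr : r ⊆ ((Prog.guard (P.qvar ∪ r) (ι × J) ψ Q).seq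
            (Prog.unitary (P.qvar ∪ r) U)).qvar),
          Disjoint r (Prog.choice P b R).qvar ∧
          (∀ i j, Q (i, j) = R i ∨ Q (i, j) = Prog.abort) ∧
          (Cmd.block r (DensityOp.pure φ₀ hφ₀)
            ((Prog.guard (P.qvar ∪ r) (ι × J) ψ Q).seq (Prog.unitary (P.qvar ∪ r) U)) hr).WF ∧
          Cmd.Equivalent
            (Cmd.prog (Prog.choice P b R))
            (Cmd.block r (DensityOp.pure φ₀ hφ₀)
              ((Prog.guard (P.qvar ∪ r) (ι × J) ψ Q).seq (Prog.unitary (P.qvar ∪ r) U)) hr)) := by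
  refine ⟨fun q U ι _ b R hWF => ⟨⟨?_, ⟨hWF.2.2.1, hWF.2.2.2⟩, trivial⟩,
    equivalent_choice_unitary q U ι b R hWF.2.2.1⟩, fun hB P ι _ b R hWF =>
    exists_equivalent_block hB P ι b R hWF⟩
  exact Set.disjoint_empty _
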